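/- Let $\mathcal G$ be a weighted directed graph on a finite set $\mathcal V$ of agents, without self-loops, with nonnegative weights $a_{ij}$ and neighbour sets $\mathcal N_i=\{j: a_{ij}>0\}$. Suppose $\mathcal G$ has a rooted-out branch: some node has directed paths to all other nodes, where $j\in\mathcal N_i$ gives an edge from $j$ to $i$ (information flows from $j$ to $i$). Let $L_H$ be its Laplacian, $(L_H)_{ii}=\sum_{k\in\mathcal N_i}a_{ik}$ and $(L_H)_{ij}=-a_{ij}$ for $i\ne j$. Let $k_u>0$ and let $l_{ij}>0$ for $j\in\mathcal N_i$. Agent $i$ has a fixed orientation $C_i\in\mathrm{SO}(3)$ and a fixed position $p_i\in\mathbb R^3$; put $C_{ji}=C_jC_i^{-1}$ and $p^i_{ji}=C_i(p_j-p_i)$. Let the auxiliary variables $z_{i,1},z_{i,2}:[t_0,\infty)\to\mathbb R^3$ satisfy the orientation estimation law $$\dot z_{i,k}=\sum_{j\in\mathcal N_i}a_{ij}\,(C_{ji}^{-1}z_{j,k}-z_{i,k}),\qquad i\in\mathcal V,\ k\in\{1,2\}.$$ At each time at which $z_{i,1},z_{i,2}$ are linearly independent, let $\hat C_i=[\,b_{i,1}\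 b_{i,2}\ b_{i,3}\,]\in\mathrm{SO}(3)$, where $b_{i,1},b_{i,2}$ result from the Gram–Schmidt process applied to $z_{i,1},z_{i,2}$ and $b_{i,3}=b_{i,1}\times b_{i,2}$. Let $\mathbf q_k=(C_i^{-1}z_{i,k})_{i\in\mathcal V}$, and suppose that $\mathbf q_1(t_0),\mathbf q_2(t_0)$ are linearly independent modulo the column space $\mathbf C(L_H\otimes I_3)$, i.e. $c_1\mathbf q_1(t_0)+c_2\mathbf q_2(t_0)\notin \mathbf C(L_H\otimes I_3)$ for all $(c_1,c_2)\ne(0,0)$. Then there are constants $\lambda,\eta>0$ such that for every family of continuous functions $\hat p_i:[t_0,\infty)\to\mathbb R^3$ (with arbitrary initial values) satisfying the position estimation law $$\dot{\hat p}_i=k_u\sum_{j\in\mathcal N_i}l_{ij}\,(\hat p_j-\hat p_i-\hat C_i^{T}p^i_{ji}),\qquad i\in\mathcal V,$$ at all times at which $\hat C_i$ is defined, there are points $\hat p_i^\infty\in\mathbb R^3$ with $$\|\hat p_i(t)-\hat p_i^\infty\|\le \eta\, e^{-\lambda(t-t_0)}\Bigl(1+\sum_{j\in\mathcal V}\|\hat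 p_j(t_0)-\hat p_j^\infty\|\Bigr)\qquad\text{for all } t\ge t_0,\ i\in\mathcal V,$$ and $\|\hat p_j^\infty-\hat p_i^\infty\|=\|p_j-p_i\|$ for all $i,j\in\mathcal V$. -/

import Mathlib

open scoped Matrix Kronecker

noncomputable section

namespace NetLoc

/-- Points and vectors of three-dimensional space, with the Euclidean norm. -/
abbrev E3 : Type := EuclideanSpace ℝ (Fin 3)

/-- The rotation group `SO(3)`. -/
abbrev SO3 : Type := Matrix.specialOrthogonalGroup (Fin 3) ℝ

/-- The linear action of a `3 × 3` matrix on Euclidean space. -/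
def act (A : Matrix (Fin 3) (Fin 3) ℝ) (x : E3) : E3 := Matrix.toEuclideanLin A x

/-- A weighted directed graph without self-loops, given by its weighted adjacency matrix
with nonnegative entries `a i j`. -/
structure WeightedDigraph (V : Type*) where
  a : V → V → ℝ
  nonneg : ∀ i j, 0 ≤ a i j
  no_loop : ∀ i, a i i = 0

namespace WeightedDigraph

variable {V : Type*} (G : WeightedDigraph V)

/-- `j` is a neighbour of `i`, i.e. agent `i` measures, and receives the variables of,
agent `j`. -/
def IsNbr (i j : V) : Prop := 0 < G.a i j

/-- The set `N_i` of neighbours of `i`. -/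
def nbrs [Fintype V] (i : V) : Finset V :=
  open Classical in Finset.univ.filter (fun j => G.IsNbr i j)

/-- Some node has directed paths to all nodes, where the edges point in the direction of
the information flow: there is an edge from `j` to `i` when `j` is a neighbour of `i`. -/
def HasRootedOutBranch : Prop :=
  ∃ r : V, ∀ v : V, Relation.ReflTransGen (fun j i => G.IsNbr i j) r v

/-- The Laplacian matrix of the graph. -/
def laplacian [Fintype V] : Matrix V V ℝ :=
  open Classical in
  Matrix.of fun i j => if i = j then ∑ k ∈ G.nbrs i, G.a i k else - G.a i j

end WeightedDigraph

variable {V : Type*}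

/-- `C_{ji} = C_j C_i⁻¹`: the orientation of the frame of agent `j` relative to the frame of
agent `i`. -/
def relOrientation (C : V → SO3) (j i : V) : SO3 := C j * (C i)⁻¹

/-- `p_{ji}^i = C_i (p_j - p_i)`: the displacement of agent `j` relative to agent `i`,
measured in the local frame of agent `i`. -/
def relDisplacement (C : V → SO3) (p : V → E3) (j i : V) : E3 :=
  act (C i : Matrix (Fin 3) (Fin 3) ℝ) (p j - p i)

/-- The orientation estimation law, for `t ≥ t₀`: each of the two auxiliary variables
`z k i` (`k = 0, 1`) of each agent `i` satisfies
`ż_{i,k} = ∑_{j ∈ N_i} a_{ij} (C_{ji}⁻¹ z_{j,k} - z_{i,k})`. -/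
def OrientationLaw [Fintype V] (G : WeightedDigraph V) (C : V → SO3) (t₀ : ℝ)
    (z : Fin 2 → V → ℝ → E3) : Prop :=
  ∀ k i, ∀ t, t₀ ≤ t →
    HasDerivWithinAt (z k i)
      (∑ j ∈ G.nbrs i, G.a i j •
        (act (((relOrientation C j i)⁻¹ : SO3) : Matrix (Fin 3) (Fin 3) ℝ) (z k j t) - z k i t))
      (Set.Ici t₀) t

/-- First Gram–Schmidt vector of the pair `z₁, z₂`. -/
def gs1 (z₁ : E3) : E3 := ‖z₁‖⁻¹ • z₁

/-- Second Gram–Schmidt vector of the pair `z₁, z₂`. -/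
def gs2 (z₁ z₂ : E3) : E3 :=
  let v : E3 := z₂ - (inner ℝ z₂ (gs1 z₁)) • gs1 z₁
  ‖v‖⁻¹ • v

/-- The matrix `[b₁ b₂ b₃]` whose first two columns are obtained from `z₁, z₂` by the
Gram–Schmidt process and whose third column is the cross product `b₁ × b₂`. It is a rotation
when `z₁, z₂` are linearly independent. -/
def frame (z₁ z₂ : E3) : Matrix (Fin 3) (Fin 3) ℝ :=
  (Matrix.of ![(gs1 z₁).ofLp, (gs2 z₁ z₂).ofLp,
    crossProduct (gs1 z₁).ofLp (gs2 z₁ z₂).ofLp])ᵀ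

/-- The estimated orientation `Ĉ_i(t)`, built from the two auxiliary variables of agent `i`. -/
def estOrientation (z : Fin 2 → V → ℝ → E3) (i : V) (t : ℝ) : Matrix (Fin 3) (Fin 3) ℝ :=
  frame (z 0 i t) (z 1 i t)

/-- The position estimation law, for `t ≥ t₀`: the estimates `p̂_i` are continuous, and
`d/dt p̂_i = k_u ∑_{j ∈ N_i} l_{ij} (p̂_j - p̂_i - Ĉ_iᵀ p_{ji}^i)` holds at every time at which
`Ĉ_i` is defined, that is, at which the Gram–Schmidt process applies to the auxiliary variables
of agent `i` because they are linearly independent. -/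
def PositionLaw [Fintype V] (G : WeightedDigraph V) (l : V → V → ℝ) (kᵤ : ℝ) (C : V → SO3)
    (p : V → E3) (t₀ : ℝ) (z : Fin 2 → V → ℝ → E3) (phat : V → ℝ → E3) : Prop :=
  (∀ i, ContinuousOn (phat i) (Set.Ici t₀)) ∧
  ∀ i, ∀ t, t₀ ≤ t → LinearIndependent ℝ ![z 0 i t, z 1 i t] →
    HasDerivWithinAt (phat i)
      (kᵤ • ∑ j ∈ G.nbrs i, l i j •
        (phat j t - phat i t - act (estOrientation z i t)ᵀ (relDisplacement C p j i)))
      (Set.Ici t₀) t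

/-- The stacked vector `q_k(t) = (q_{1,k}(t), …, q_{N,k}(t))` with `q_{i,k} = C_i⁻¹ z_{i,k}`. -/
def qStack (C : V → SO3) (z : Fin 2 → V → ℝ → E3) (k : Fin 2) (t : ℝ) : V × Fin 3 → ℝ :=
  fun x => act (((C x.1)⁻¹ : SO3) : Matrix (Fin 3) (Fin 3) ℝ) (z k x.1 t) x.2

/-- The column space of `L ⊗ I₃`, where `L` is the Laplacian of the graph. -/
def colSpace [Fintype V] (G : WeightedDigraph V) : Submodule ℝ (V × Fin 3 → ℝ) :=
  LinearMap.range (Matrix.mulVecLin (G.laplacian ⊗ₖ (1 : Matrix (Fin 3) (Fin 3) ℝ)))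

end NetLoc

end

/-! In the global coordinates q_{i,k} = C_i⁻¹ z_{i,k} the orientation law is plain consensus in each
component, so q_{i,k} converges exponentially to a limit e_k common to all agents
(`OrientationLaw.exists_limit`). Functionals annihilating the column space of L ⊗ I₃ are conserved,
so a nontrivial vanishing combination of e_0, e_1 would put the same combination of the initial
values into that space. Hence e_0, e_1 are independent (`OrientationLaw.linearIndependent_limit`).

Gram–Schmidt frames are rotation equivariant, so Ĉ_iᵀ p_{ji}^i = F_i(t)ᵀ (p_j - p_i), where F_i(t)
is the frame of q_{i,0}, q_{i,1}. Gram–Schmidt is C¹ at independent pairs, so F_i(t) tends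
exponentially to the frame F of e_0, e_1. Thus p̂_i - Fᵀ p_i follows consensus with an exponentially
small disturbance and tends to a common vector d. The limits Fᵀ p_i + d form an isometric image of
the p_i.

The frames may be undefined at some times. Since q is analytic in t and its limits are independent,
these times are countable, and continuity of p̂ lets a mean value inequality ignore them.

Consensus itself (`exists_consensus_rate`) rests on positivity: at time one the flow carries a fixed
share δ of the root's value to every node, so the spread shrinks by 1 - δ per unit of time.
Variation of constants adds the disturbance. -/

namespace NetLoc

open Filter Topology Set

/-! ### Positivity and contraction of the consensus semigroup -/

section Consensus

variable {V : Type*} [Fintype V]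

/-- The generator `x ↦ (∑ j, W i j (x j - x i))_i` of the consensus dynamics with weights `W`. -/
noncomputable def consensusGen (W : V → V → ℝ) : (V → ℝ) →L[ℝ] (V → ℝ) :=
  LinearMap.toContinuousLinearMap
    { toFun := fun x i => ∑ j, W i j * (x j - x i)
      map_add' := fun x y => by
        funext i
        simp only [Pi.add_apply, ← Finset.sum_add_distrib]
        exact Finset.sum_congr rfl fun j _ => by ring
      map_smul' := fun c x => by
        funext i
        simp only [Pi.smul_apply, smul_eq_mul, RingHom.id_apply, Finset.mul_sum]
        exact Finset.sum_congr rfl fun j _ => by ring }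

@[simp] lemma consensusGen_apply (W : V → V → ℝ) (x : V → ℝ) (i : V) :
    consensusGen W x i = ∑ j, W i j * (x j - x i) := rfl

lemma consensusGen_const (W : V → V → ℝ) (m : ℝ) : consensusGen W (fun _ => m) = 0 := by
  funext i; simp

/-- The semigroup generated by `consensusGen W`. -/
noncomputable def consensusFlow (W : V → V → ℝ) (t : ℝ) : (V → ℝ) →L[ℝ] (V → ℝ) :=
  NormedSpace.exp (t • consensusGen W)

lemma consensusFlow_zero (W : V → V → ℝ) : consensusFlow W 0 = 1 := by
  simp [consensusFlow]

lemma consensusFlow_add (W : V → V → ℝ) (s t : ℝ) :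
    consensusFlow W (s + t) = consensusFlow W s * consensusFlow W t := by
  let := NormedAlgebra.restrictScalars ℚ ℝ ((V → ℝ) →L[ℝ] (V → ℝ))
  rw [consensusFlow, add_smul, NormedSpace.exp_add_of_commute]
  · rfl
  · exact ((Commute.refl _).smul_left _).smul_right _

lemma hasDerivAt_consensusFlow (W : V → V → ℝ) (t : ℝ) :
    HasDerivAt (consensusFlow W) (consensusFlow W t * consensusGen W) t :=
  hasDerivAt_exp_smul_const (𝕂 := ℝ) (consensusGen W) t

lemma hasSum_exp_apply (X : (V → ℝ) →L[ℝ] (V → ℝ)) (x : V → ℝ) (i : V) :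
    HasSum (fun n : ℕ => ((n.factorial : ℝ)⁻¹) * (X ^ n) x i) (NormedSpace.exp X x i) := by
  have h := NormedSpace.exp_series_hasSum_exp' (𝕂 := ℝ) X
  have h2 := h.mapL ((ContinuousLinearMap.proj (R := ℝ) (φ := fun _ : V => ℝ) i).comp
    (ContinuousLinearMap.apply ℝ (V → ℝ) x))
  simpa using h2

lemma consensusFlow_const (W : V → V → ℝ) (t m : ℝ) :
    consensusFlow W t (fun _ => m) = fun _ => m := by
  funext i
  have h := hasSum_exp_apply (t • consensusGen W) (fun _ => m) i
  refine h.unique ?_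
  convert hasSum_ite_eq (0 : ℕ) m using 1
  funext n
  cases n with
  | zero => simp
  | succ n =>
    have h0 : ((t • consensusGen W) ^ (n + 1)) (fun _ : V => m) = 0 := by
      rw [pow_succ, mul_apply_eq_comp]
      simp only [smul_apply, consensusGen_const, smul_zero, map_zero]
    simp [h0]

/-- The positive operator `consensusGen W + c`. -/
noncomputable def shiftedGen (W : V → V → ℝ) : (V → ℝ) →L[ℝ] (V → ℝ) :=
  consensusGen W + (∑ i, ∑ j, W i j) • 1

lemma shiftedGen_apply (W : V → V → ℝ) (x : V → ℝ) (i : V) :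
    shiftedGen W x i = ∑ j, W i j * x j + (∑ k, ∑ j, W k j - ∑ j, W i j) * x i := by
  simp only [shiftedGen, add_apply, Pi.add_apply, consensusGen_apply,
    smul_apply, one_apply_eq_self, Pi.smul_apply, smul_eq_mul,
    mul_sub, Finset.sum_sub_distrib, ← Finset.sum_mul]
  ring

/-- The shift makes the coefficient of `x i` nonnegative, so every term of the row is. The case j =
i gives positivity; an edge from j to i gives propagation of strict positivity. -/
lemma le_shiftedGen_apply {W : V → V → ℝ} (hW : ∀ i j, 0 ≤ W i j) {x : V → ℝ}
    (hx : ∀ i, 0 ≤ x i) (i j : V) : W i j * x j ≤ shiftedGen W x i := by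
  rw [shiftedGen_apply]
  have h1 : W i j * x j ≤ ∑ j, W i j * x j :=
    Finset.single_le_sum (f := fun j => W i j * x j)
      (fun j _ => mul_nonneg (hW i j) (hx j)) (Finset.mem_univ j)
  have h2 : ∑ j, W i j ≤ ∑ k, ∑ j, W k j :=
    Finset.single_le_sum (f := fun k => ∑ j, W k j)
      (fun k _ => Finset.sum_nonneg fun j _ => hW k j) (Finset.mem_univ i)
  have h3 := mul_nonneg (sub_nonneg.2 h2) (hx i)
  linarith

lemma shiftedGen_pow_nonneg {W : V → V → ℝ} (hW : ∀ i j, 0 ≤ W i j) {x : V → ℝ}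
    (hx : ∀ i, 0 ≤ x i) (n : ℕ) (i : V) : 0 ≤ (shiftedGen W ^ n) x i := by
  induction n generalizing i with
  | zero => simpa using hx i
  | succ n ih =>
    rw [pow_succ']
    exact (mul_nonneg (hW i i) (ih i)).trans (le_shiftedGen_apply hW ih i i)

/-- Multiples of the identity commute with everything, so the shift only contributes a scalar
factor. For nonnegative weights, signs can then be read off the power series. -/
lemma consensusFlow_eq_shifted (W : V → V → ℝ) (t : ℝ) (x : V → ℝ) (i : V) :
    consensusFlow W t x i =
      Real.exp (-(t * ∑ i, ∑ j, W i j)) * NormedSpace.exp (t • shiftedGen W) x i := by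
  let := NormedAlgebra.restrictScalars ℚ ℝ ((V → ℝ) →L[ℝ] (V → ℝ))
  set c := ∑ i, ∑ j, W i j
  have h : t • consensusGen W = t • shiftedGen W + (-(t * c)) • (1 : (V → ℝ) →L[ℝ] (V → ℝ)) := by
    rw [shiftedGen, smul_add, smul_smul, add_assoc, ← add_smul]
    simp [c]
  have hc : NormedSpace.exp ((-(t * c)) • (1 : (V → ℝ) →L[ℝ] (V → ℝ))) =
      Real.exp (-(t * c)) • 1 := by
    have := NormedSpace.algebraMap_exp_comm (𝔸 := (V → ℝ) →L[ℝ] (V → ℝ)) (-(t * c))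
    rw [Algebra.algebraMap_eq_smul_one, Algebra.algebraMap_eq_smul_one] at this
    rw [← this, Real.exp_eq_exp_ℝ]
  rw [consensusFlow, h, NormedSpace.exp_add_of_commute ((Commute.one_right _).smul_right _), hc]
  simp

/-- All terms of the series are nonnegative, so each one bounds the sum from below. -/
lemma exp_shifted_ge {W : V → V → ℝ} (hW : ∀ i j, 0 ≤ W i j) {t : ℝ} (ht : 0 ≤ t) {x : V → ℝ}
    (hx : ∀ i, 0 ≤ x i) (n : ℕ) (i : V) :
    (n.factorial : ℝ)⁻¹ * (t ^ n * (shiftedGen W ^ n) x i) ≤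
      NormedSpace.exp (t • shiftedGen W) x i := by
  have h := hasSum_exp_apply (t • shiftedGen W) x i
  have := le_hasSum h n fun m _ => by
    simp only [smul_pow, smul_apply, Pi.smul_apply, smul_eq_mul]
    have := shiftedGen_pow_nonneg hW hx m i
    positivity
  simpa [smul_pow] using this

lemma consensusFlow_nonneg {W : V → V → ℝ} (hW : ∀ i j, 0 ≤ W i j) {t : ℝ} (ht : 0 ≤ t)
    {x : V → ℝ} (hx : ∀ i, 0 ≤ x i) (i : V) : 0 ≤ consensusFlow W t x i := by
  rw [consensusFlow_eq_shifted]
  refine mul_nonneg (Real.exp_pos _).le (le_trans ?_ (exp_shifted_ge hW ht hx 0 i))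
  simpa using hx i

lemma consensusFlow_mono {W : V → V → ℝ} (hW : ∀ i j, 0 ≤ W i j) {t : ℝ} (ht : 0 ≤ t)
    {x y : V → ℝ} (hxy : ∀ i, x i ≤ y i) (i : V) :
    consensusFlow W t x i ≤ consensusFlow W t y i := by
  have := consensusFlow_nonneg hW ht (x := y - x) (fun i => sub_nonneg.2 (hxy i)) i
  rw [map_sub] at this
  exact sub_nonneg.1 this

/-- At time one the flow spreads the mass of a root to all nodes. -/
lemma exists_consensusFlow_root_ge {W : V → V → ℝ} (hW : ∀ i j, 0 ≤ W i j) [DecidableEq V] {r : V}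
    (hr : ∀ v, Relation.ReflTransGen (fun j i => 0 < W i j) r v) :
    ∃ δ > 0, ∀ i, δ ≤ consensusFlow W 1 (Pi.single r 1) i := by
  have hx : ∀ i, (0 : ℝ) ≤ (Pi.single r 1 : V → ℝ) i := fun i => by
    by_cases h : i = r
    · subst h; simp
    · simp [h]
  have hpos : ∀ i, 0 < consensusFlow W 1 (Pi.single r 1) i := by
    intro i
    -- Here n is the length of a path from the root to i: each edge costs one power.
    obtain ⟨n, hn⟩ : ∃ n, 0 < (shiftedGen W ^ n) (Pi.single r 1) i := by
      induction hr i with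
      | refl => exact ⟨0, by simp⟩
      | tail _ hbc ih =>
        obtain ⟨n, hn⟩ := ih
        refine ⟨n + 1, ?_⟩
        rw [pow_succ']
        exact (mul_pos hbc hn).trans_le
          (le_shiftedGen_apply hW (shiftedGen_pow_nonneg hW hx n) _ _)
    rw [consensusFlow_eq_shifted]
    refine mul_pos (Real.exp_pos _) (lt_of_lt_of_le ?_ (exp_shifted_ge hW zero_le_one hx n i))
    positivity
  have : Nonempty V := ⟨r⟩
  obtain ⟨i₀, hi₀⟩ := Finite.exists_min fun i => consensusFlow W 1 (Pi.single r 1) i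
  exact ⟨_, hpos i₀, hi₀⟩

lemma consensusFlow_mem_Icc {W : V → V → ℝ} (hW : ∀ i j, 0 ≤ W i j) {t : ℝ} (ht : 0 ≤ t)
    {x : V → ℝ} {a b : ℝ} (hx : ∀ i, x i ∈ Icc a b) (i : V) : consensusFlow W t x i ∈ Icc a b := by
  have h1 := consensusFlow_mono hW ht (x := fun _ => a) (fun i => (hx i).1) i
  have h2 := consensusFlow_mono hW ht (y := fun _ => b) (fun i => (hx i).2) i
  rw [consensusFlow_const] at h1 h2
  exact ⟨h1, h2⟩

lemma consensusFlow_one_contract {W : V → V → ℝ} (hW : ∀ i j, 0 ≤ W i j) [DecidableEq V] {r : V}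
    {δ : ℝ} (hδ : ∀ i, δ ≤ consensusFlow W 1 (Pi.single r 1) i)
    {x : V → ℝ} {a b : ℝ} (hx : ∀ i, x i ∈ Icc a b) :
    ∃ a' b', b' - a' = (1 - δ) * (b - a) ∧ ∀ i, consensusFlow W 1 x i ∈ Icc a' b' := by
  -- A nonnegative y dominates its part at the root, which the flow spreads to all nodes. Applied to
  -- x - a and b - x, this raises the lower and lowers the upper end of the interval.
  have key : ∀ y : V → ℝ, (∀ i, 0 ≤ y i) → ∀ i, δ * y r ≤ consensusFlow W 1 y i := by
    intro y hy i
    have h := consensusFlow_mono hW zero_le_one (x := y r • Pi.single r 1) (y := y) (fun k => by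
      by_cases hk : k = r
      · subst hk; simp
      · simp [hk, hy k]) i
    rw [map_smul, Pi.smul_apply, smul_eq_mul] at h
    nlinarith [hδ i, hy r]
  refine ⟨a + δ * (x r - a), b - δ * (b - x r), by ring, fun i => ⟨?_, ?_⟩⟩
  · have h := key (x - fun _ => a) (fun k => sub_nonneg.2 (hx k).1) i
    rw [map_sub, consensusFlow_const] at h
    simp only [Pi.sub_apply] at h
    linarith
  · have h := key ((fun _ => b) - x) (fun k => sub_nonneg.2 (hx k).2) i
    rw [map_sub, consensusFlow_const] at h
    simp only [Pi.sub_apply] at h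
    linarith

lemma exists_Icc_of_abs_sub_le [Nonempty V] {x : V → ℝ} {d : ℝ} (hx : ∀ i j, |x i - x j| ≤ d) :
    ∃ a, ∀ i, x i ∈ Icc a (a + d) := by
  obtain ⟨i₀, hi₀⟩ := Finite.exists_min x
  exact ⟨x i₀, fun i => ⟨hi₀ i, by linarith [(abs_le.1 (hx i i₀)).2]⟩⟩

/-- The disagreement of the agents decays exponentially along the consensus flow. -/
lemma exists_consensusFlow_decay {W : V → V → ℝ} (hW : ∀ i j, 0 ≤ W i j) {r : V}
    (hr : ∀ v, Relation.ReflTransGen (fun j i => 0 < W i j) r v) :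
    ∃ lam > 0, ∃ K > 0, ∀ (x : V → ℝ) (d : ℝ), (∀ i j, |x i - x j| ≤ d) → ∀ t, 0 ≤ t → ∀ i j,
      |consensusFlow W t x i - consensusFlow W t x j| ≤ K * Real.exp (-lam * t) * d := by
  classical
  have : Nonempty V := ⟨r⟩
  obtain ⟨δ₀, hδ₀, hδ₀'⟩ := exists_consensusFlow_root_ge hW hr
  -- The cap 1/2 keeps 1 - δ positive, so that its logarithm can serve as the rate.
  set δ := min δ₀ (1 / 2) with hδdef
  have hδ : 0 < δ := lt_min hδ₀ (by norm_num)
  have hδ1 : δ ≤ 1 / 2 := min_le_right _ _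
  have hδ' : ∀ i, δ ≤ consensusFlow W 1 (Pi.single r 1) i :=
    fun i => (min_le_left _ _).trans (hδ₀' i)
  have hstep : ∀ (n : ℕ) (x : V → ℝ) (a b : ℝ), (∀ i, x i ∈ Icc a b) →
      ∃ a' b', b' - a' = (1 - δ) ^ n * (b - a) ∧ ∀ i, consensusFlow W n x i ∈ Icc a' b' := by
    intro n
    induction n with
    | zero => exact fun x a b hx => ⟨a, b, by simp, by simpa [consensusFlow_zero] using hx⟩
    | succ n ih =>
      intro x a b hx
      obtain ⟨a', b', hab, hx'⟩ := ih x a b hx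
      obtain ⟨a'', b'', hab', hx''⟩ := consensusFlow_one_contract hW hδ' hx'
      refine ⟨a'', b'', by rw [hab', hab]; ring, fun i => ?_⟩
      rw [Nat.cast_succ, add_comm, consensusFlow_add]
      exact hx'' i
  -- Only the ⌊t⌋ > t - 1 full unit steps contract; the factor (1 - δ)⁻¹ pays for the fractional
  -- rest, which merely preserves the interval.
  refine ⟨-Real.log (1 - δ), by linarith [Real.log_neg (x := 1 - δ) (by linarith) (by linarith)],
    (1 - δ)⁻¹, inv_pos.2 (by linarith), fun x d hd t ht i j => ?_⟩
  have hd0 : 0 ≤ d := (abs_nonneg _).trans (hd r r)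
  obtain ⟨a, ha⟩ := exists_Icc_of_abs_sub_le hd
  obtain ⟨a', b', hab, hx'⟩ := hstep ⌊t⌋₊ x _ _ ha
  have hx'' := fun i => consensusFlow_mem_Icc hW (sub_nonneg.2 (Nat.floor_le ht)) hx' i
  have hflow : consensusFlow W t x =
      consensusFlow W (t - ⌊t⌋₊) (consensusFlow W ⌊t⌋₊ x) := by
    conv_lhs => rw [← sub_add_cancel t (⌊t⌋₊ : ℝ), consensusFlow_add]
    rfl
  rw [hflow]
  have h1 := hx'' i
  have h2 := hx'' j
  have h3 : |consensusFlow W (t - ⌊t⌋₊) (consensusFlow W ⌊t⌋₊ x) i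
      - consensusFlow W (t - ⌊t⌋₊) (consensusFlow W ⌊t⌋₊ x) j| ≤ b' - a' :=
    abs_le.2 ⟨by linarith [h1.1, h2.2], by linarith [h1.2, h2.1]⟩
  refine h3.trans ?_
  rw [hab, add_sub_cancel_left]
  refine mul_le_mul_of_nonneg_right ?_ hd0
  have hq : 0 < 1 - δ := by linarith
  have : (1 - δ)⁻¹ * Real.exp (- -Real.log (1 - δ) * t) = (1 - δ) ^ (t - 1) := by
    rw [Real.rpow_sub hq, Real.rpow_one, Real.rpow_def_of_pos hq, neg_neg, div_eq_mul_inv, mul_comm]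
  rw [this, ← Real.rpow_natCast]
  exact Real.rpow_le_rpow_of_exponent_ge hq (by linarith) (by linarith [Nat.lt_floor_add_one t])

end Consensus

/-! ### Consensus with a decaying disturbance -/

section ConsensusConvergence

/-- A mean value inequality that tolerates countably many exceptional points. -/
lemma abs_sub_le_of_deriv_le_off_countable {g B B' : ℝ → ℝ} {a b : ℝ} (hab : a ≤ b) {N : Set ℝ}
    (hN : N.Countable) (hg : ContinuousOn g (Icc a b))
    (hd : ∀ x ∈ Ioo a b \ N, ∃ g', HasDerivAt g g' x ∧ |g'| ≤ B' x)
    (hB : ∀ x, HasDerivAt B (B' x) x) (hB' : Continuous B') : |g b - g a| ≤ B b - B a := by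
  have hae : ∀ᵐ x : ℝ, x ∈ Ioc a b → ‖deriv g x‖ ≤ B' x := by
    have h1 : ∀ᵐ x : ℝ, x ∉ N := hN.ae_notMem _
    have h2 : ∀ᵐ x : ℝ, x ∉ ({b} : Set ℝ) := (countable_singleton b).ae_notMem _
    filter_upwards [h1, h2] with x hx hxb hxI
    obtain ⟨g', hg', hle⟩ := hd x ⟨⟨hxI.1, lt_of_le_of_ne hxI.2 hxb⟩, hx⟩
    rwa [hg'.deriv, Real.norm_eq_abs]
  have hBi : IntervalIntegrable B' MeasureTheory.volume a b := hB'.intervalIntegrable _ _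
  have hi : IntervalIntegrable (deriv g) MeasureTheory.volume a b := by
    refine hBi.mono_fun' (aestronglyMeasurable_deriv _ _) ?_
    rw [uIoc_of_le hab]
    exact (MeasureTheory.ae_restrict_iff' measurableSet_Ioc).2 hae
  have h1 := MeasureTheory.integral_eq_of_hasDerivAt_off_countable_of_le g (deriv g) hab hN hg
    (fun x hx => by
      obtain ⟨g', hg', -⟩ := hd x hx
      rw [hg'.deriv]; exact hg') hi
  have h2 := intervalIntegral.norm_integral_le_of_norm_le hab hae hBi
  rw [h1, intervalIntegral.integral_eq_sub_of_hasDerivAt (fun x _ => hB x) hBi] at h2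
  exact h2

/-- A function whose increments after time `s` are controlled by a null function of `s`
converges. -/
lemma exists_tendsto_of_abs_sub_le {f ε : ℝ → ℝ} {t₀ : ℝ}
    (h : ∀ s t, t₀ ≤ s → s ≤ t → |f t - f s| ≤ ε s) (hε : Tendsto ε atTop (𝓝 0)) :
    ∃ e, Tendsto f atTop (𝓝 e) ∧ ∀ s, t₀ ≤ s → |f s - e| ≤ ε s := by
  obtain ⟨e, he⟩ : ∃ e, Tendsto f atTop (𝓝 e) := by
    have hc : Cauchy (map f atTop) := by
      rw [Metric.cauchy_iff]
      refine ⟨inferInstance, fun r hr => ?_⟩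
      obtain ⟨s, hs, hs'⟩ := ((hε.eventually (gt_mem_nhds (half_pos hr))).and
        (eventually_ge_atTop t₀)).exists
      refine ⟨f '' Ici s, image_mem_map (Ici_mem_atTop s), ?_⟩
      rintro _ ⟨x, hx, rfl⟩ _ ⟨y, hy, rfl⟩
      have h1 := abs_le.1 (h s x hs' hx)
      have h2 := abs_le.1 (h s y hs' hy)
      rw [Real.dist_eq, abs_lt]
      constructor <;> linarith
    exact cauchy_iff_exists_le_nhds.1 hc
  refine ⟨e, he, fun s hs => ?_⟩
  have : Tendsto (fun t => |f s - f t|) atTop (𝓝 |f s - e|) := (tendsto_const_nhds.sub he).abs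
  refine le_of_tendsto this ?_
  filter_upwards [eventually_ge_atTop s] with t ht
  rw [abs_sub_comm]
  exact h s t hs ht

variable {V : Type*} [Fintype V]

/-- Variation of constants in differential form: differentiating the flow cancels the generator
term, and only the transported disturbance remains. -/
lemma hasDerivWithinAt_consensusFlow_sub {W : V → V → ℝ} {y : ℝ → V → ℝ} {v : V → ℝ} {S : Set ℝ}
    {s : ℝ} (t : ℝ) (h : HasDerivWithinAt y (consensusGen W (y s) + v) S s) :
    HasDerivWithinAt (fun s => consensusFlow W (t - s) (y s)) (consensusFlow W (t - s) v) S s := by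
  have h1 : HasDerivWithinAt (fun s => consensusFlow W (t - s))
      (-(consensusFlow W (t - s) * consensusGen W)) S s := by
    have := (hasDerivAt_consensusFlow W (t - s)).scomp s ((hasDerivAt_id s).const_sub t)
    simpa [Function.comp_def] using this.hasDerivWithinAt
  have h2 := h1.clm_apply h
  refine h2.congr_deriv ?_
  rw [map_add, neg_apply, mul_apply_eq_comp]
  abel

/-- Solutions of the homogeneous consensus dynamics are given by the consensus flow. -/
lemma eq_consensusFlow_of_hasDerivWithinAt {W : V → V → ℝ} {y : ℝ → V → ℝ} {t₀ : ℝ}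
    (h : ∀ t, t₀ ≤ t → HasDerivWithinAt y (consensusGen W (y t)) (Ici t₀) t) {t : ℝ}
    (ht : t₀ ≤ t) : y t = consensusFlow W (t - t₀) (y t₀) := by
  have hd : ∀ s, t₀ ≤ s →
      HasDerivWithinAt (fun s => consensusFlow W (t - s) (y s)) 0 (Ici t₀) s := by
    intro s hs
    have := hasDerivWithinAt_consensusFlow_sub (W := W) (v := 0) t (by simpa using h s hs)
    simpa using this
  have hc := constant_of_has_deriv_right_zero (a := t₀) (b := t)
    (f := fun s => consensusFlow W (t - s) (y s))
    (fun s hs => ((hd s hs.1).continuousWithinAt).mono Icc_subset_Ici_self)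
    (fun s hs => (hd s hs.1).mono (Ici_subset_Ici.2 hs.1)) t (right_mem_Icc.2 ht)
  simpa [consensusFlow_zero] using hc

lemma hasDerivAt_exp_neg_mul (A μ t₀ x : ℝ) (hμ : μ ≠ 0) :
    HasDerivAt (fun s => -(A / μ) * Real.exp (-μ * (s - t₀)))
      (A * Real.exp (-μ * (x - t₀))) x := by
  have h : HasDerivAt (fun s => -μ * (s - t₀)) (-μ) x := by
    simpa using ((hasDerivAt_id x).sub_const t₀).const_mul (-μ)
  refine (h.exp.const_mul (-(A / μ))).congr_deriv ?_
  field_simp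

/-- Consensus with an exponentially decaying disturbance: the agents converge exponentially to a
common value. -/
theorem exists_consensus_rate {W : V → V → ℝ} (hW : ∀ i j, 0 ≤ W i j) {r : V}
    (hr : ∀ v, Relation.ReflTransGen (fun j i => 0 < W i j) r v) {μ₀ : ℝ} (hμ₀ : 0 < μ₀)
    {c : ℝ} (hc : 0 ≤ c) :
    ∃ μ > 0, ∃ K > 0, ∀ (t₀ : ℝ) (y v : ℝ → V → ℝ) (N : Set ℝ), N.Countable →
      ContinuousOn y (Ici t₀) →
      (∀ t, t₀ < t → t ∉ N → HasDerivAt y (consensusGen W (y t) + v t) t) →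
      (∀ t, t₀ < t → t ∉ N → ∀ i, |v t i| ≤ c * Real.exp (-μ₀ * (t - t₀))) →
      ∃ e, ∀ t, t₀ ≤ t → ∀ i,
        |y t i - e| ≤ K * Real.exp (-μ * (t - t₀)) * (1 + ∑ j, |y t₀ j - e|) := by
  obtain ⟨lam, hlam, K₁, hK₁, hdecay⟩ := exists_consensusFlow_decay hW hr
  -- Halving `lam` makes μ < `lam` strictly, so the convolution of the two exponentials has no
  -- resonance and is at most exp(-μ(t - t₀)) / (`lam` - μ).
  set μ := min μ₀ (lam / 2) with hμdef
  have hμ : 0 < μ := lt_min hμ₀ (half_pos hlam)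
  have hμlam : μ ≤ lam / 2 := min_le_right _ _
  have hgap : 0 < lam - μ := by linarith
  set K₂ := K₁ + 2 * c * K₁ / (lam - μ) with hK₂def
  have hK₂ : 0 < K₂ := by positivity
  set w := ∑ i, ∑ j, W i j with hwdef
  have hw : 0 ≤ w := Finset.sum_nonneg fun i _ => Finset.sum_nonneg fun j _ => hW i j
  -- A bound for velocities: w K₂ from the disagreement, c from the disturbance, and 1 to keep the
  -- constant positive.
  set K₃ := w * K₂ + c + 1 with hK₃def
  have hK₃ : 0 < K₃ := by positivity
  refine ⟨μ, hμ, 2 * K₃ / μ, by positivity, fun t₀ y v N hN hy hyd hv => ?_⟩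
  have hv' : ∀ t, t₀ < t → t ∉ N → ∀ i, |v t i| ≤ c * Real.exp (-μ * (t - t₀)) := by
    intro t ht htN i
    refine (hv t ht htN i).trans (mul_le_mul_of_nonneg_left (Real.exp_le_exp.2 ?_) hc)
    have : μ ≤ μ₀ := min_le_left _ _
    nlinarith
  have hyc : ∀ i, ContinuousOn (fun t => y t i) (Ici t₀) := fun i => continuousOn_pi.1 hy i
  -- The bound d on the initial disagreement stays free because it is chosen twice: crudely to get
  -- the limit, then in terms of the distances to that limit.
  have hosc : ∀ d, (∀ i j, |y t₀ i - y t₀ j| ≤ d) → ∀ t, t₀ ≤ t → ∀ i j,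
      |y t i - y t j| ≤ K₂ * (1 + d) * Real.exp (-μ * (t - t₀)) := by
    intro d hd t ht i j
    have hd0 : 0 ≤ d := (abs_nonneg _).trans (hd i j)
    -- g joins the disagreement of the undisturbed flow (s = t₀) to that of y at time t (s = t); its
    -- derivative sees only v.
    set g : ℝ → ℝ := fun s => consensusFlow W (t - s) (y s) i - consensusFlow W (t - s) (y s) j
    set A := 2 * c * K₁ / (lam - μ)
    have hA : 0 ≤ A := by positivity
    have hflowc : ContinuousOn (fun s => consensusFlow W (t - s) (y s)) (Icc t₀ t) := by
      refine ContinuousOn.clm_apply (Continuous.continuousOn ?_) (hy.mono Icc_subset_Ici_self)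
      have : Continuous (consensusFlow W) :=
        continuous_iff_continuousAt.2 fun t => (hasDerivAt_consensusFlow W t).continuousAt
      exact this.comp (continuous_const.sub continuous_id)
    have hmv := abs_sub_le_of_deriv_le_off_countable (g := g)
      (B := fun s => A * Real.exp (-lam * (t - s) + -μ * (s - t₀)))
      (B' := fun s => (2 * c * K₁) * Real.exp (-lam * (t - s) + -μ * (s - t₀))) ht hN
      ((continuousOn_pi.1 hflowc i).sub (continuousOn_pi.1 hflowc j)) (by
        intro s hs
        have hd1 := (hasDerivWithinAt_consensusFlow_sub t
          (hyd s hs.1.1 hs.2).hasDerivWithinAt (S := univ)).hasDerivAt univ_mem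
        refine ⟨_, (hasDerivAt_pi.1 hd1 i).sub (hasDerivAt_pi.1 hd1 j), ?_⟩
        refine (hdecay (v s) (2 * (c * Real.exp (-μ * (s - t₀)))) (fun k k' => ?_) (t - s)
          (by linarith [hs.1.2]) i j).trans (le_of_eq ?_)
        · have h1 := abs_le.1 (hv' s hs.1.1 hs.2 k)
          have h2 := abs_le.1 (hv' s hs.1.1 hs.2 k')
          exact abs_le.2 ⟨by linarith, by linarith⟩
        · rw [Real.exp_add]; ring)
      (fun s => by
        have h : HasDerivAt (fun s => -lam * (t - s) + -μ * (s - t₀)) (lam - μ) s := by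
          have h1 := ((hasDerivAt_id s).const_sub t).const_mul (-lam)
          have h2 := ((hasDerivAt_id s).sub_const t₀).const_mul (-μ)
          exact (h1.add h2).congr_deriv (by ring)
        refine (h.exp.const_mul A).congr_deriv ?_
        simp only [A]
        field_simp)
      (by fun_prop)
    have hgt : g t = y t i - y t j := by simp [g, consensusFlow_zero]
    have hg0 := hdecay (y t₀) d hd (t - t₀) (by linarith) i j
    have he1 : Real.exp (-lam * (t - t₀)) ≤ Real.exp (-μ * (t - t₀)) := by
      apply Real.exp_le_exp.2
      nlinarith
    have he0 := Real.exp_pos (-μ * (t - t₀))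
    have he2 : 0 ≤ A * Real.exp (-lam * (t - t₀) + -μ * (t₀ - t₀)) := by positivity
    rw [← hgt]
    have h1 : |g t| ≤ |g t - g t₀| + |g t₀| := by
      have := abs_add_le (g t - g t₀) (g t₀)
      rwa [sub_add_cancel] at this
    have h2 : |g t₀| ≤ K₁ * Real.exp (-μ * (t - t₀)) * d :=
      hg0.trans (by gcongr)
    simp only [sub_self, mul_zero, zero_add, add_zero] at hmv he2
    have h3 : |g t| ≤ A * Real.exp (-μ * (t - t₀)) + K₁ * Real.exp (-μ * (t - t₀)) * d := by
      linarith
    refine h3.trans ?_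
    have h4 : K₂ * (1 + d) * Real.exp (-μ * (t - t₀)) -
        (A * Real.exp (-μ * (t - t₀)) + K₁ * Real.exp (-μ * (t - t₀)) * d) =
        (K₁ + A * d) * Real.exp (-μ * (t - t₀)) := by
      simp only [hK₂def, A]; ring
    have h5 : 0 ≤ (K₁ + A * d) * Real.exp (-μ * (t - t₀)) := by positivity
    linarith
  have hinc : ∀ d, (∀ i j, |y t₀ i - y t₀ j| ≤ d) → ∀ i s t, t₀ ≤ s → s ≤ t →
      |y t i - y s i| ≤ K₃ * (1 + d) / μ * Real.exp (-μ * (s - t₀)) := by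
    intro d hd i s t hs hst
    have hd0 : 0 ≤ d := (abs_nonneg _).trans (hd i i)
    have hmv := abs_sub_le_of_deriv_le_off_countable (g := fun t => y t i)
      (B := fun s => -(K₃ * (1 + d) / μ) * Real.exp (-μ * (s - t₀)))
      (B' := fun s => K₃ * (1 + d) * Real.exp (-μ * (s - t₀))) hst hN
      ((hyc i).mono fun x hx => hs.trans hx.1) (by
        intro x hx
        have hx0 : t₀ < x := hs.trans_lt hx.1.1
        refine ⟨_, hasDerivAt_pi.1 (hyd x hx0 hx.2) i, ?_⟩
        have hE := Real.exp_pos (-μ * (x - t₀))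
        set E := Real.exp (-μ * (x - t₀))
        have h1 : |∑ j, W i j * (y x j - y x i)| ≤ w * (K₂ * (1 + d) * E) := by
          calc |∑ j, W i j * (y x j - y x i)| ≤ ∑ j, |W i j * (y x j - y x i)| :=
                Finset.abs_sum_le_sum_abs _ _
            _ ≤ ∑ j, W i j * (K₂ * (1 + d) * E) := by
                refine Finset.sum_le_sum fun j _ => ?_
                rw [abs_mul, abs_of_nonneg (hW i j)]
                exact mul_le_mul_of_nonneg_left (hosc d hd x hx0.le j i) (hW i j)
            _ = (∑ j, W i j) * (K₂ * (1 + d) * E) := by rw [Finset.sum_mul]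
            _ ≤ w * (K₂ * (1 + d) * E) := by
                refine mul_le_mul_of_nonneg_right ?_ (by positivity)
                exact Finset.single_le_sum (f := fun k => ∑ j, W k j)
                  (fun k _ => Finset.sum_nonneg fun j _ => hW k j) (Finset.mem_univ i)
        have h2 := hv' x hx0 hx.2 i
        rw [Pi.add_apply, consensusGen_apply]
        refine (abs_add_le _ _).trans ((add_le_add h1 h2).trans ?_)
        have h3 : K₃ * (1 + d) * E - (w * (K₂ * (1 + d) * E) + c * E) =
            (1 + d + c * d) * E := by
          simp only [hK₃def]; ring
        have h4 : 0 ≤ (1 + d + c * d) * E := by positivity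
        linarith)
      (fun s => hasDerivAt_exp_neg_mul _ μ t₀ s hμ.ne')
      (by fun_prop)
    have : 0 ≤ K₃ * (1 + d) / μ * Real.exp (-μ * (t - t₀)) := by positivity
    simp only [neg_mul] at hmv this ⊢
    linarith
  have hexp : ∀ A : ℝ, Tendsto (fun s => A * Real.exp (-μ * (s - t₀))) atTop (𝓝 0) := by
    intro A
    rw [← mul_zero A]
    refine Tendsto.const_mul A (Real.tendsto_exp_atBot.comp ?_)
    exact (tendsto_atTop_add_const_right _ _ tendsto_id).const_mul_atTop_of_neg (neg_neg_of_pos hμ)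
  have hd₀ : ∀ i j, |y t₀ i - y t₀ j| ≤ ∑ i, ∑ j, |y t₀ i - y t₀ j| := fun i j =>
    (Finset.single_le_sum (f := fun j => |y t₀ i - y t₀ j|) (fun _ _ => abs_nonneg _)
      (Finset.mem_univ j)).trans
    (Finset.single_le_sum (f := fun i => ∑ j, |y t₀ i - y t₀ j|)
      (fun _ _ => Finset.sum_nonneg fun _ _ => abs_nonneg _) (Finset.mem_univ i))
  choose e he _ using fun i => exists_tendsto_of_abs_sub_le (hinc _ hd₀ i) (hexp _)
  have hee : ∀ i, e i = e r := by
    intro i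
    have h1 : Tendsto (fun t => y t i - y t r) atTop (𝓝 (e i - e r)) := (he i).sub (he r)
    have h2 : Tendsto (fun t => y t i - y t r) atTop (𝓝 0) := by
      refine squeeze_zero_norm' ?_ (hexp (K₂ * (1 + ∑ i, ∑ j, |y t₀ i - y t₀ j|)))
      filter_upwards [eventually_ge_atTop t₀] with t ht
      exact hosc _ hd₀ t ht i r
    exact sub_eq_zero.1 (tendsto_nhds_unique h1 h2)
  refine ⟨e r, fun t ht i => ?_⟩
  -- Second pass: with the limit known, d = 2Z bounds the initial disagreement, and uniqueness of
  -- limits identifies the new limit with the old.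
  set Z := ∑ j, |y t₀ j - e r| with hZ
  have hd : ∀ i j, |y t₀ i - y t₀ j| ≤ 2 * Z := by
    intro i j
    have hi := Finset.single_le_sum (f := fun j => |y t₀ j - e r|) (fun _ _ => abs_nonneg _)
      (Finset.mem_univ i)
    have hj := Finset.single_le_sum (f := fun j => |y t₀ j - e r|) (fun _ _ => abs_nonneg _)
      (Finset.mem_univ j)
    have h := abs_sub_le (y t₀ i) (e r) (y t₀ j)
    rw [abs_sub_comm (e r)] at h
    linarith
  obtain ⟨e', he', hle⟩ := exists_tendsto_of_abs_sub_le (hinc _ hd i) (hexp _)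
  have hee' : e' = e r := (tendsto_nhds_unique he' (he i)).trans (hee i)
  rw [← hee']
  refine (hle t ht).trans ?_
  have hZ0 : 0 ≤ Z := Finset.sum_nonneg fun _ _ => abs_nonneg _
  have hE := Real.exp_pos (-μ * (t - t₀))
  have : K₃ * (1 + 2 * Z) / μ ≤ 2 * K₃ / μ * (1 + Z) := by
    rw [div_mul_eq_mul_div]
    gcongr ?_ / μ
    nlinarith
  calc _ ≤ 2 * K₃ / μ * (1 + Z) * Real.exp (-μ * (t - t₀)) := by gcongr
    _ = _ := by ring

end ConsensusConvergence

/-! ### Gram–Schmidt frames: equivariance, regularity, orthogonality -/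

section Frames

@[simp] lemma ofLp_act (A : Matrix (Fin 3) (Fin 3) ℝ) (x : E3) :
    (act A x).ofLp = A *ᵥ x.ofLp := rfl

lemma act_mul (A B : Matrix (Fin 3) (Fin 3) ℝ) (x : E3) : act (A * B) x = act A (act B x) := by
  apply (WithLp.ofLp_injective 2)
  simp

lemma act_one (x : E3) : act 1 x = x := by
  apply (WithLp.ofLp_injective 2)
  simp

lemma act_smul (A : Matrix (Fin 3) (Fin 3) ℝ) (c : ℝ) (x : E3) : act A (c • x) = c • act A x :=
  map_smul _ _ _

lemma act_sub (A : Matrix (Fin 3) (Fin 3) ℝ) (x y : E3) : act A (x - y) = act A x - act A y :=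
  map_sub _ _ _

lemma transpose_mul_self_SO3 (A : SO3) :
    (A : Matrix (Fin 3) (Fin 3) ℝ)ᵀ * (A : Matrix (Fin 3) (Fin 3) ℝ) = 1 :=
  (Matrix.mem_orthogonalGroup_iff' _ _).1 (Matrix.mem_specialOrthogonalGroup_iff.1 A.2).1

lemma det_SO3 (A : SO3) : (A : Matrix (Fin 3) (Fin 3) ℝ).det = 1 :=
  (Matrix.mem_specialOrthogonalGroup_iff.1 A.2).2

lemma inner_act_of_transpose_mul {A : Matrix (Fin 3) (Fin 3) ℝ} (hA : Aᵀ * A = 1) (x y : E3) :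
    inner ℝ (act A x) (act A y) = inner ℝ x y := by
  simp only [EuclideanSpace.inner_eq_star_dotProduct, ofLp_act, star_trivial]
  rw [Matrix.dotProduct_mulVec, Matrix.vecMul_mulVec, hA, Matrix.vecMul_one]

lemma norm_act_of_transpose_mul {A : Matrix (Fin 3) (Fin 3) ℝ} (hA : Aᵀ * A = 1) (x : E3) :
    ‖act A x‖ = ‖x‖ := by
  rw [@norm_eq_sqrt_real_inner, @norm_eq_sqrt_real_inner, inner_act_of_transpose_mul hA]

/-- The cofactor identity, valid also for singular A; for a rotation the cofactor matrix is A
itself. -/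
lemma cross_mulVec_mulVec (A : Matrix (Fin 3) (Fin 3) ℝ) (u v : Fin 3 → ℝ) :
    crossProduct (A *ᵥ u) (A *ᵥ v) = A.adjugateᵀ *ᵥ crossProduct u v := by
  funext i
  fin_cases i <;>
  · simp [Matrix.adjugate_fin_three, cross_apply, Matrix.mulVec, dotProduct, Fin.sum_univ_three]
    ring

lemma cross_mulVec_SO3 (A : SO3) (u v : Fin 3 → ℝ) :
    crossProduct ((A : Matrix (Fin 3) (Fin 3) ℝ) *ᵥ u) ((A : Matrix (Fin 3) (Fin 3) ℝ) *ᵥ v) =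
      (A : Matrix (Fin 3) (Fin 3) ℝ) *ᵥ crossProduct u v := by
  have h : (A : Matrix (Fin 3) (Fin 3) ℝ).adjugate = (A : Matrix (Fin 3) (Fin 3) ℝ)ᵀ := by
    have h1 := Matrix.mul_adjugate (A : Matrix (Fin 3) (Fin 3) ℝ)
    rw [det_SO3, one_smul] at h1
    calc _ = ((A : Matrix (Fin 3) (Fin 3) ℝ)ᵀ * (A : Matrix (Fin 3) (Fin 3) ℝ)) *
          (A : Matrix (Fin 3) (Fin 3) ℝ).adjugate := by rw [transpose_mul_self_SO3, one_mul]
      _ = _ := by rw [mul_assoc, h1, mul_one]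
  rw [cross_mulVec_mulVec, h, Matrix.transpose_transpose]

lemma gs1_act (A : SO3) (x : E3) :
    gs1 (act (A : Matrix (Fin 3) (Fin 3) ℝ) x) = act (A : Matrix (Fin 3) (Fin 3) ℝ) (gs1 x) := by
  rw [gs1, gs1, act_smul, norm_act_of_transpose_mul (transpose_mul_self_SO3 A)]

lemma gs2_act (A : SO3) (x y : E3) :
    gs2 (act (A : Matrix (Fin 3) (Fin 3) ℝ) x) (act (A : Matrix (Fin 3) (Fin 3) ℝ) y) =
      act (A : Matrix (Fin 3) (Fin 3) ℝ) (gs2 x y) := by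
  simp only [gs2]
  rw [gs1_act, inner_act_of_transpose_mul (transpose_mul_self_SO3 A), ← act_smul, ← act_sub,
    norm_act_of_transpose_mul (transpose_mul_self_SO3 A), act_smul]

/-- Gram–Schmidt frames are equivariant under rotations. -/
lemma frame_act (A : SO3) (x y : E3) :
    frame (act (A : Matrix (Fin 3) (Fin 3) ℝ) x) (act (A : Matrix (Fin 3) (Fin 3) ℝ) y) =
      (A : Matrix (Fin 3) (Fin 3) ℝ) * frame x y := by
  ext i j
  rw [frame, gs1_act, gs2_act, ofLp_act, ofLp_act, cross_mulVec_SO3]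
  fin_cases j <;> rfl

lemma gs1_ne_zero_of_linearIndependent {x y : E3} (h : LinearIndependent ℝ ![x, y]) : x ≠ 0 :=
  h.ne_zero 0

lemma gs2_ne_zero_of_linearIndependent {x y : E3} (h : LinearIndependent ℝ ![x, y]) :
    y - (inner ℝ y (gs1 x)) • gs1 x ≠ 0 := by
  intro h0
  rw [gs1, smul_smul] at h0
  have := (LinearIndependent.pair_iff.1 h) (-(inner ℝ y (‖x‖⁻¹ • x) * ‖x‖⁻¹)) 1 (by
    rw [neg_smul, one_smul, neg_add_eq_sub]; exact h0)
  exact one_ne_zero this.2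

lemma norm_inv_smul_self_le (x : E3) : ‖‖x‖⁻¹ • x‖ ≤ 1 := by
  rw [norm_smul, norm_inv, norm_norm]
  exact inv_mul_le_one

lemma abs_apply_le_norm (x : E3) (a : Fin 3) : |x a| ≤ ‖x‖ := PiLp.norm_apply_le x a

lemma norm_le_sum_abs (x : E3) : ‖x‖ ≤ ∑ a, |x a| := by
  rw [EuclideanSpace.norm_eq]
  refine Real.sqrt_le_iff.2 ⟨Finset.sum_nonneg fun _ _ => abs_nonneg _, ?_⟩
  exact Finset.sum_sq_le_sq_sum_of_nonneg fun _ _ => abs_nonneg _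

/-- No independence is needed: since 0⁻¹ = 0, normalised vectors have norm at most one even in
degenerate cases. This boundedness makes the local Lipschitz estimate global. -/
lemma abs_frame_le (x y : E3) (a b : Fin 3) : |frame x y a b| ≤ 2 := by
  have h1 : ∀ a, |gs1 x a| ≤ 1 := fun a =>
    (abs_apply_le_norm _ a).trans (norm_inv_smul_self_le x)
  have h2 : ∀ a, |gs2 x y a| ≤ 1 := fun a =>
    (abs_apply_le_norm _ a).trans (norm_inv_smul_self_le _)
  have h3 : ∀ a b c d, |gs1 x a * gs2 x y b - gs1 x c * gs2 x y d| ≤ 2 := by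
    intro a b c d
    refine (abs_sub _ _).trans ?_
    rw [abs_mul, abs_mul]
    have := mul_le_one₀ (h1 a) (abs_nonneg _) (h2 b)
    have := mul_le_one₀ (h1 c) (abs_nonneg _) (h2 d)
    linarith
  fin_cases b
  · exact (h1 a).trans one_le_two
  · exact (h2 a).trans one_le_two
  · fin_cases a
    · exact h3 1 2 2 1
    · exact h3 2 0 0 2
    · exact h3 0 1 1 0

lemma contDiffAt_gs1 {x : E3} (hx : x ≠ 0) : ContDiffAt ℝ 1 gs1 x :=
  ((contDiffAt_norm ℝ hx).inv (norm_ne_zero_iff.2 hx)).smul contDiffAt_id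

lemma contDiffAt_gs2 {q : E3 × E3} (h : LinearIndependent ℝ ![q.1, q.2]) :
    ContDiffAt ℝ 1 (fun q : E3 × E3 => gs2 q.1 q.2) q := by
  have h1 : ContDiffAt ℝ 1 (fun q : E3 × E3 => gs1 q.1) q :=
    (contDiffAt_gs1 (gs1_ne_zero_of_linearIndependent h)).comp q contDiffAt_fst
  have hv : ContDiffAt ℝ 1
      (fun q : E3 × E3 => q.2 - (inner ℝ q.2 (gs1 q.1)) • gs1 q.1) q :=
    contDiffAt_snd.sub ((contDiffAt_snd.inner ℝ h1).smul h1)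
  have h0 := gs2_ne_zero_of_linearIndependent h
  exact ((hv.norm ℝ h0).inv (norm_ne_zero_iff.2 h0)).smul hv

lemma contDiffAt_frame {q : E3 × E3} (h : LinearIndependent ℝ ![q.1, q.2]) (a b : Fin 3) :
    ContDiffAt ℝ 1 (fun q : E3 × E3 => frame q.1 q.2 a b) q := by
  have h1 : ContDiffAt ℝ 1 (fun q : E3 × E3 => gs1 q.1) q :=
    (contDiffAt_gs1 (gs1_ne_zero_of_linearIndependent h)).comp q contDiffAt_fst
  have h1' : ∀ a, ContDiffAt ℝ 1 (fun q : E3 × E3 => gs1 q.1 a) q :=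
    fun a => (contDiffAt_euclidean.1 h1) a
  have h2' : ∀ a, ContDiffAt ℝ 1 (fun q : E3 × E3 => gs2 q.1 q.2 a) q :=
    fun a => (contDiffAt_euclidean.1 (contDiffAt_gs2 h)) a
  have h3 : ∀ a b c d, ContDiffAt ℝ 1 (fun q : E3 × E3 =>
      gs1 q.1 a * gs2 q.1 q.2 b - gs1 q.1 c * gs2 q.1 q.2 d) q := fun a b c d =>
    ((h1' a).mul (h2' b)).sub ((h1' c).mul (h2' d))
  fin_cases b
  · exact h1' a
  · exact h2' a
  · fin_cases a
    · exact h3 1 2 2 1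
    · exact h3 2 0 0 2
    · exact h3 0 1 1 0

/-- A bounded function that is `C¹` at a point satisfies a global Lipschitz estimate based at that
point. -/
lemma exists_abs_sub_le_of_contDiffAt {E : Type*} [NormedAddCommGroup E] [NormedSpace ℝ E]
    {f : E → ℝ} {q : E} (hf : ContDiffAt ℝ 1 f q) {M : ℝ} (hM : ∀ x, |f x| ≤ M) :
    ∃ K > 0, ∀ x, |f x - f q| ≤ K * ‖x - q‖ := by
  obtain ⟨K, s, hs, hK⟩ := hf.exists_lipschitzOnWith
  obtain ⟨ε, hε, hεs⟩ := Metric.mem_nhds_iff.1 hs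
  have hM0 : 0 ≤ M := (abs_nonneg _).trans (hM q)
  refine ⟨K + 2 * M / ε + 1, by positivity, fun x => ?_⟩
  have hn := norm_nonneg (x - q)
  have hA : 0 ≤ 2 * M / ε * ‖x - q‖ := by positivity
  have hB : 0 ≤ (K : ℝ) * ‖x - q‖ := by positivity
  by_cases hx : x ∈ Metric.ball q ε
  · have := hK.dist_le_mul x (hεs hx) q (hεs (Metric.mem_ball_self hε))
    rw [Real.dist_eq, dist_eq_norm] at this
    nlinarith
  -- Away from q the difference is at most 2M, while the distance is at least ε.
  · rw [Metric.mem_ball, not_lt, dist_eq_norm] at hx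
    have h1 : |f x - f q| ≤ 2 * M := by
      have := abs_le.1 (hM x)
      have := abs_le.1 (hM q)
      exact abs_le.2 ⟨by linarith, by linarith⟩
    have h2 : 2 * M ≤ 2 * M / ε * ‖x - q‖ := by
      rw [div_mul_eq_mul_div, le_div_iff₀ hε]
      exact mul_le_mul_of_nonneg_left hx (by positivity)
    nlinarith

lemma exists_abs_frame_sub_le {x y : E3} (h : LinearIndependent ℝ ![x, y]) :
    ∃ K > 0, ∀ x' y' a b, |frame x' y' a b - frame x y a b| ≤ K * (‖x' - x‖ + ‖y' - y‖) := by
  choose K hK0 hK using fun a b : Fin 3 =>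
    exists_abs_sub_le_of_contDiffAt (contDiffAt_frame (q := (x, y)) h a b)
      (fun q => abs_frame_le q.1 q.2 a b)
  have hle : ∀ a b, K a b ≤ ∑ a, ∑ b, K a b := fun a b =>
    (Finset.single_le_sum (f := fun b => K a b) (fun b _ => (hK0 a b).le)
      (Finset.mem_univ b)).trans
    (Finset.single_le_sum (f := fun a => ∑ b, K a b)
      (fun a _ => Finset.sum_nonneg fun b _ => (hK0 a b).le) (Finset.mem_univ a))
  refine ⟨∑ a, ∑ b, K a b, (hK0 0 0).trans_le (hle 0 0), fun x' y' a b => ?_⟩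
  refine (hK a b (x', y')).trans (mul_le_mul (hle a b) ?_ (norm_nonneg _)
    ((hK0 0 0).trans_le (hle 0 0)).le)
  rw [Prod.mk_sub_mk, Prod.norm_def]
  exact max_le_add_of_nonneg (norm_nonneg _) (norm_nonneg _)

/-- The frame of a linearly independent pair is orthogonal. -/
lemma frame_transpose_mul_self {x y : E3} (h : LinearIndependent ℝ ![x, y]) :
    (frame x y)ᵀ * frame x y = 1 := by
  have hx := gs1_ne_zero_of_linearIndependent h
  have hv := gs2_ne_zero_of_linearIndependent h
  have hunit : ∀ u : E3, u ≠ 0 → inner ℝ (‖u‖⁻¹ • u) (‖u‖⁻¹ • u) = (1 : ℝ) := by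
    intro u hu
    rw [real_inner_self_eq_norm_sq, norm_smul, norm_inv, norm_norm,
      inv_mul_cancel₀ (norm_ne_zero_iff.2 hu), one_pow]
  have h11 : inner ℝ (gs1 x) (gs1 x) = (1 : ℝ) := hunit x hx
  have h22 : inner ℝ (gs2 x y) (gs2 x y) = (1 : ℝ) := hunit _ hv
  have h12 : inner ℝ (gs1 x) (gs2 x y) = (0 : ℝ) := by
    simp only [gs2]
    rw [inner_smul_right, inner_sub_right, inner_smul_right, h11, real_inner_comm]
    simp
  have e : ∀ u v : E3, inner ℝ u v = u.ofLp ⬝ᵥ v.ofLp := fun u v => by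
    rw [EuclideanSpace.inner_eq_star_dotProduct, star_trivial, dotProduct_comm]
  rw [e] at h11 h12 h22
  set b₁ := (gs1 x).ofLp
  set b₂ := (gs2 x y).ofLp
  have h21 : b₂ ⬝ᵥ b₁ = 0 := by rw [dotProduct_comm, h12]
  have h33 : crossProduct b₁ b₂ ⬝ᵥ crossProduct b₁ b₂ = 1 := by
    rw [cross_dot_cross, h11, h22, h12]; simp
  have h13 := dot_self_cross b₁ b₂
  have h23 := dot_cross_self b₁ b₂
  have h31 : crossProduct b₁ b₂ ⬝ᵥ b₁ = 0 := by rw [dotProduct_comm, h13]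
  have h32 : crossProduct b₁ b₂ ⬝ᵥ b₂ = 0 := by rw [dotProduct_comm, h23]
  ext i j
  fin_cases i <;> fin_cases j
  · exact h11
  · exact h12
  · exact h13
  · exact h21
  · exact h22
  · exact h23
  · exact h31
  · exact h32
  · exact h33

lemma norm_act_frame_transpose {x y : E3} (h : LinearIndependent ℝ ![x, y]) (w : E3) :
    ‖act (frame x y)ᵀ w‖ = ‖w‖ :=
  norm_act_of_transpose_mul (by
    rw [Matrix.transpose_transpose]
    exact mul_eq_one_comm.1 (frame_transpose_mul_self h)) w

end Frames

/-! ### Limits of the auxiliary variables and the exceptional times -/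

section Orientation

/-- Turns dependence into the vanishing of 2 × 2 minors, to which analyticity applies. -/
lemma linearIndependent_iff_cross (x y : E3) :
    LinearIndependent ℝ ![x, y] ↔ crossProduct x.ofLp y.ofLp ≠ 0 := by
  rw [crossProduct_ne_zero_iff_linearIndependent, LinearIndependent.pair_iff,
    LinearIndependent.pair_iff]
  have : ∀ s t : ℝ, s • x + t • y = 0 ↔ s • x.ofLp + t • y.ofLp = 0 := fun s t => by
    rw [← WithLp.ofLp_eq_zero 2 (x := s • x + t • y), WithLp.ofLp_add, WithLp.ofLp_smul,
      WithLp.ofLp_smul]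
  simp only [this]

lemma linearIndependent_act_iff (A : SO3) (x y : E3) :
    LinearIndependent ℝ
        ![act (A : Matrix (Fin 3) (Fin 3) ℝ) x, act (A : Matrix (Fin 3) (Fin 3) ℝ) y] ↔
      LinearIndependent ℝ ![x, y] := by
  rw [linearIndependent_iff_cross, linearIndependent_iff_cross, ofLp_act, ofLp_act,
    cross_mulVec_SO3, not_iff_not]
  refine ⟨fun h => ?_, fun h => by rw [h, Matrix.mulVec_zero]⟩
  rw [← Matrix.one_mulVec (crossProduct x.ofLp y.ofLp), ← transpose_mul_self_SO3 A,
    ← Matrix.mulVec_mulVec, h, Matrix.mulVec_zero]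

/-- The zero set of a real analytic function that does not vanish identically is countable. -/
lemma countable_zeros_of_analytic {f : ℝ → ℝ} (hf : AnalyticOnNhd ℝ f univ) {a : ℝ}
    (ha : f a ≠ 0) : {t | f t = 0}.Countable := by
  rcases hf.eqOn_zero_or_eventually_ne_zero_of_preconnected isPreconnected_univ with h | h
  · exact absurd (h (mem_univ a)) ha
  · have h1 : IsDiscrete ({t | f t = 0} ∩ univ) := by
      refine isDiscrete_of_codiscreteWithin ?_
      filter_upwards [h] with x hx using hx
    rw [inter_univ] at h1
    have := h1.to_subtype
    exact (TopologicalSpace.separableSpace_iff_countable (α := {t | f t = 0})).1 inferInstance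

variable {V : Type*} [Fintype V]

lemma analyticOnNhd_consensusFlow (W : V → V → ℝ) (t₀ : ℝ) (x : V → ℝ) (i : V) :
    AnalyticOnNhd ℝ (fun t => consensusFlow W (t - t₀) x i) univ := by
  intro t _
  have h1 : AnalyticAt ℝ (fun t => (t - t₀) • consensusGen W) t :=
    (analyticAt_id.sub analyticAt_const).smul analyticAt_const
  have h2 : AnalyticAt ℝ (fun t => consensusFlow W (t - t₀)) t :=
    (NormedSpace.exp_analytic (𝕂 := ℝ) ((t - t₀) • consensusGen W)).comp
      (f := fun t => (t - t₀) • consensusGen W) h1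
  exact (((ContinuousLinearMap.proj (R := ℝ) (φ := fun _ : V => ℝ) i).comp
    (ContinuousLinearMap.apply ℝ (V → ℝ) x)).analyticAt _).comp h2

lemma WeightedDigraph.mem_nbrs (G : WeightedDigraph V) {i j : V} :
    j ∈ G.nbrs i ↔ G.IsNbr i j := by
  classical
  rw [WeightedDigraph.nbrs, Finset.mem_filter]
  exact and_iff_right (Finset.mem_univ j)

lemma WeightedDigraph.sum_nbrs_mul (G : WeightedDigraph V) (i : V) (f : V → ℝ) :
    ∑ j ∈ G.nbrs i, G.a i j * f j = ∑ j, G.a i j * f j := by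
  classical
  refine Finset.sum_subset (Finset.subset_univ _) fun j _ hj => ?_
  have : ¬ 0 < G.a i j := fun h => hj (G.mem_nbrs.2 h)
  rw [le_antisymm (not_lt.1 this) (G.nonneg i j), zero_mul]

lemma WeightedDigraph.laplacian_mulVec (G : WeightedDigraph V) (x : V → ℝ) :
    G.laplacian *ᵥ x = -consensusGen G.a x := by
  classical
  funext i
  have h1 := G.sum_nbrs_mul i (fun _ => 1)
  simp only [mul_one] at h1
  have h2 : ∀ j, G.laplacian i j * x j =
      (if i = j then (∑ k, G.a i k) * x j else 0) - G.a i j * x j := by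
    intro j
    simp only [WeightedDigraph.laplacian, Matrix.of_apply, h1]
    by_cases hij : i = j
    · subst hij; simp [G.no_loop]
    · simp [hij]
  simp only [Matrix.mulVec, dotProduct, h2, Finset.sum_sub_distrib, Pi.neg_apply,
    consensusGen_apply, mul_sub, ← Finset.sum_mul]
  simp

lemma kronecker_one_mulVec (L : Matrix V V ℝ) (y : V × Fin 3 → ℝ) (x : V × Fin 3) :
    ((L ⊗ₖ (1 : Matrix (Fin 3) (Fin 3) ℝ)) *ᵥ y) x = (L *ᵥ fun i => y (i, x.2)) x.1 := by
  simp only [Matrix.mulVec, dotProduct, Fintype.sum_prod_type, Matrix.kroneckerMap_apply,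
    Matrix.one_apply]
  simp

/-- A solution of the consensus dynamics that tends to zero starts in the column space of the
Laplacian. -/
lemma mem_colSpace_of_tendsto_zero (G : WeightedDigraph V) {t₀ : ℝ} {Q : Fin 3 → ℝ → V → ℝ}
    (hQ : ∀ a t, t₀ ≤ t → HasDerivWithinAt (Q a) (consensusGen G.a (Q a t)) (Ici t₀) t)
    (h0 : ∀ a i, Tendsto (fun t => Q a t i) atTop (𝓝 0)) :
    (fun x : V × Fin 3 => Q x.2 t₀ x.1) ∈ colSpace G := by
  by_contra hmem
  -- f kills the column space but not the initial vector. It is constant along the solution, yet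
  -- must tend to zero.
  obtain ⟨f, hf, hker⟩ := Submodule.exists_le_ker_of_notMem hmem
  set F : (V × Fin 3 → ℝ) →L[ℝ] ℝ := LinearMap.toContinuousLinearMap f
  set Y : ℝ → V × Fin 3 → ℝ := fun t x => Q x.2 t x.1 with hY
  have hYd : ∀ t, t₀ ≤ t →
      HasDerivWithinAt Y (fun x => consensusGen G.a (Q x.2 t) x.1) (Ici t₀) t := fun t ht =>
    hasDerivWithinAt_pi.2 fun x => hasDerivWithinAt_pi.1 (hQ x.2 t ht) x.1
  have hrange : ∀ t, F (fun x => consensusGen G.a (Q x.2 t) x.1) = 0 := by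
    intro t
    refine hker (x := fun x => consensusGen G.a (Q x.2 t) x.1) ⟨-Y t, ?_⟩
    funext x
    rw [map_neg, Pi.neg_apply, Matrix.mulVecLin_apply, kronecker_one_mulVec,
      G.laplacian_mulVec, Pi.neg_apply, neg_neg]
  have hFd : ∀ t, t₀ ≤ t → HasDerivWithinAt (fun t => F (Y t)) 0 (Ici t₀) t := fun t ht => by
    have := F.hasFDerivAt.comp_hasDerivWithinAt t (hYd t ht)
    rwa [hrange] at this
  have hconst : ∀ t, t₀ ≤ t → F (Y t) = F (Y t₀) := fun t ht =>
    constant_of_has_deriv_right_zero (a := t₀) (b := t)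
      (fun s hs => ((hFd s hs.1).continuousWithinAt).mono Icc_subset_Ici_self)
      (fun s hs => (hFd s hs.1).mono (Ici_subset_Ici.2 hs.1)) t (right_mem_Icc.2 ht)
  have hlim : Tendsto (fun t => F (Y t)) atTop (𝓝 (F 0)) :=
    (F.continuous.tendsto 0).comp (tendsto_pi_nhds.2 fun x => h0 x.2 x.1)
  have hlim' : Tendsto (fun t => F (Y t)) atTop (𝓝 (F (Y t₀))) := by
    refine tendsto_const_nhds.congr' ?_
    filter_upwards [eventually_ge_atTop t₀] with t ht
    exact (hconst t ht).symm
  have := tendsto_nhds_unique hlim' hlim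
  rw [map_zero] at this
  exact hf this

/-- The auxiliary variable of an agent, expressed in the global frame. -/
noncomputable def globalAux {V : Type*} (C : V → SO3) (z : Fin 2 → V → ℝ → E3) (k : Fin 2) (i : V) (t : ℝ) : E3 :=
  act (((C i)⁻¹ : SO3) : Matrix (Fin 3) (Fin 3) ℝ) (z k i t)

lemma act_globalAux {V : Type*} (C : V → SO3) (z : Fin 2 → V → ℝ → E3) (k : Fin 2) (i : V) (t : ℝ) :
    act (C i : Matrix (Fin 3) (Fin 3) ℝ) (globalAux C z k i t) = z k i t := by
  rw [globalAux, ← act_mul]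
  have : (C i : Matrix (Fin 3) (Fin 3) ℝ) * (((C i)⁻¹ : SO3) : Matrix (Fin 3) (Fin 3) ℝ) = 1 := by
    rw [← Submonoid.coe_mul, mul_inv_cancel, Submonoid.coe_one]
  rw [this, act_one]

/-- In the global frame, the orientation estimation law is the consensus dynamics. -/
lemma OrientationLaw.hasDerivWithinAt_globalAux {G : WeightedDigraph V} {C : V → SO3} {t₀ : ℝ}
    {z : Fin 2 → V → ℝ → E3} (hz : OrientationLaw G C t₀ z) (k : Fin 2) (a : Fin 3) {t : ℝ}
    (ht : t₀ ≤ t) :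
    HasDerivWithinAt (fun t i => globalAux C z k i t a)
      (consensusGen G.a fun i => globalAux C z k i t a) (Ici t₀) t := by
  refine hasDerivWithinAt_pi.2 fun i => ?_
  set T : E3 →L[ℝ] E3 := LinearMap.toContinuousLinearMap
    (Matrix.toEuclideanLin (((C i)⁻¹ : SO3) : Matrix (Fin 3) (Fin 3) ℝ)) with hT
  have hTa : ∀ x, T x = act (((C i)⁻¹ : SO3) : Matrix (Fin 3) (Fin 3) ℝ) x := fun x => rfl
  have h1 := ((EuclideanSpace.proj (𝕜 := ℝ) a).comp T).hasFDerivAt.comp_hasDerivWithinAt t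
    (hz k i t ht)
  refine h1.congr_deriv ?_
  rw [ContinuousLinearMap.comp_apply, map_sum, map_sum, consensusGen_apply, ← G.sum_nbrs_mul i]
  refine Finset.sum_congr rfl fun j _ => ?_
  rw [map_smul, map_smul, map_sub, map_sub, hTa, hTa, ← act_mul]
  have : (((C i)⁻¹ : SO3) : Matrix (Fin 3) (Fin 3) ℝ) *
      (((relOrientation C j i)⁻¹ : SO3) : Matrix (Fin 3) (Fin 3) ℝ) =
      (((C j)⁻¹ : SO3) : Matrix (Fin 3) (Fin 3) ℝ) := by
    rw [← Submonoid.coe_mul]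
    congr 1
    simp [relOrientation]
  rw [this]
  rfl

/-- Under the orientation estimation law the auxiliary variables, in the global frame, converge
exponentially to common limits. -/
lemma OrientationLaw.exists_limit {G : WeightedDigraph V} (hG : G.HasRootedOutBranch)
    {C : V → SO3} {t₀ : ℝ} {z : Fin 2 → V → ℝ → E3} (hz : OrientationLaw G C t₀ z) :
    ∃ μ > 0, ∃ K > 0, ∃ e : Fin 2 → E3, ∀ k i t, t₀ ≤ t →
      ‖globalAux C z k i t - e k‖ ≤ K * Real.exp (-μ * (t - t₀)) := by
  obtain ⟨r, hr⟩ := hG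
  -- Undisturbed case: amplitude c = 0, with the arbitrary rate 1.
  obtain ⟨μ, hμ, K, hK, hcons⟩ := exists_consensus_rate G.nonneg hr one_pos le_rfl
  have hlim : ∀ k a, ∃ e, ∀ t, t₀ ≤ t → ∀ i, |globalAux C z k i t a - e| ≤
      K * Real.exp (-μ * (t - t₀)) * (1 + ∑ j, |globalAux C z k j t₀ a - e|) := by
    intro k a
    have hd := fun t (ht : t₀ ≤ t) => hz.hasDerivWithinAt_globalAux k a ht
    refine hcons t₀ (fun t i => globalAux C z k i t a) 0 ∅ countable_empty
      (fun t ht => (hd t ht).continuousWithinAt) (fun t ht _ => ?_) (fun t _ _ i => by simp)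
    simpa using (hd t ht.le).hasDerivAt (Ici_mem_nhds ht)
  choose e he using hlim
  set S : Fin 2 → Fin 3 → ℝ := fun k a => 1 + ∑ j, |globalAux C z k j t₀ a - e k a|
  have hS : ∀ k a, 0 < S k a := fun k a => by positivity
  have hSle : ∀ k, ∑ a, S k a ≤ ∑ k, ∑ a, S k a := fun k =>
    Finset.single_le_sum (f := fun k => ∑ a, S k a)
      (fun k _ => Finset.sum_nonneg fun a _ => (hS k a).le) (Finset.mem_univ k)
  have hSpos : 0 < ∑ k, ∑ a, S k a :=
    Finset.sum_pos (fun k _ => Finset.sum_pos (fun a _ => hS k a) ⟨0, Finset.mem_univ _⟩)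
      ⟨0, Finset.mem_univ _⟩
  refine ⟨μ, hμ, K * ∑ k, ∑ a, S k a, by positivity, fun k => WithLp.toLp 2 (e k),
    fun k i t ht => ?_⟩
  calc ‖globalAux C z k i t - WithLp.toLp 2 (e k)‖
      ≤ ∑ a, |globalAux C z k i t a - e k a| := norm_le_sum_abs _
    _ ≤ ∑ a, K * Real.exp (-μ * (t - t₀)) * S k a := Finset.sum_le_sum fun a _ => he k a t ht i
    _ = K * Real.exp (-μ * (t - t₀)) * ∑ a, S k a := by rw [Finset.mul_sum]
    _ ≤ K * Real.exp (-μ * (t - t₀)) * ∑ k, ∑ a, S k a := by gcongr; exact hSle k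
    _ = _ := by ring

lemma tendsto_of_norm_sub_le_exp {f : ℝ → E3} {e : E3} {t₀ K μ : ℝ} (hμ : 0 < μ)
    (h : ∀ t, t₀ ≤ t → ‖f t - e‖ ≤ K * Real.exp (-μ * (t - t₀))) : Tendsto f atTop (𝓝 e) := by
  rw [tendsto_iff_norm_sub_tendsto_zero]
  refine squeeze_zero' (Eventually.of_forall fun _ => norm_nonneg _)
    ((eventually_ge_atTop t₀).mono h) ?_
  rw [← mul_zero K]
  refine Tendsto.const_mul K (Real.tendsto_exp_atBot.comp ?_)
  exact (tendsto_atTop_add_const_right _ _ tendsto_id).const_mul_atTop_of_neg (neg_neg_of_pos hμ)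

/-- The limits of the auxiliary variables are linearly independent when the initial values are
linearly independent modulo the column space of the Laplacian. -/
lemma OrientationLaw.linearIndependent_limit {G : WeightedDigraph V} {C : V → SO3} {t₀ : ℝ} {z : Fin 2 → V → ℝ → E3} (hz : OrientationLaw G C t₀ z)
    (hq : ∀ c : Fin 2 → ℝ, c ≠ 0 →
      c 0 • qStack C z 0 t₀ + c 1 • qStack C z 1 t₀ ∉ colSpace G)
    {e : Fin 2 → E3} (he : ∀ k i, Tendsto (globalAux C z k i) atTop (𝓝 (e k))) :
    LinearIndependent ℝ ![e 0, e 1] := by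
  rw [LinearIndependent.pair_iff]
  intro c₀ c₁ hc
  by_contra hne
  refine hq ![c₀, c₁] (fun h => hne ⟨congrFun h 0, congrFun h 1⟩) ?_
  refine mem_colSpace_of_tendsto_zero G (t₀ := t₀)
    (Q := fun a t i => c₀ * globalAux C z 0 i t a + c₁ * globalAux C z 1 i t a) ?_ ?_
  · intro a t ht
    have h := ((hz.hasDerivWithinAt_globalAux 0 a ht).const_smul c₀).add
      ((hz.hasDerivWithinAt_globalAux 1 a ht).const_smul c₁)
    rw [← map_smul, ← map_smul, ← map_add] at h
    exact h
  · intro a i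
    have h : ∀ k, Tendsto (fun t => globalAux C z k i t a) atTop (𝓝 (e k a)) := fun k =>
      ((EuclideanSpace.proj (𝕜 := ℝ) a).continuous.tendsto (e k)).comp (he k i)
    have h0 : c₀ * e 0 a + c₁ * e 1 a = 0 := by
      have := congrArg (fun x : E3 => x a) hc
      simpa using this
    rw [← h0]
    exact ((h 0).const_mul c₀).add ((h 1).const_mul c₁)

/-- The Gram–Schmidt process applies to the auxiliary variables except at countably many times. -/
lemma OrientationLaw.countable_not_linearIndependent {G : WeightedDigraph V} {C : V → SO3}
    {t₀ : ℝ} {z : Fin 2 → V → ℝ → E3} (hz : OrientationLaw G C t₀ z)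
    {e : Fin 2 → E3} (he : ∀ k i, Tendsto (globalAux C z k i) atTop (𝓝 (e k)))
    (hLI : LinearIndependent ℝ ![e 0, e 1]) (i : V) :
    {t | t₀ ≤ t ∧ ¬ LinearIndependent ℝ ![z 0 i t, z 1 i t]}.Countable := by
  rw [linearIndependent_iff_cross] at hLI
  -- The flow extends the solution from [t₀, ∞) to an analytic function on the whole line.
  set φ : Fin 2 → Fin 3 → ℝ → ℝ := fun k a t =>
    consensusFlow G.a (t - t₀) (fun i => globalAux C z k i t₀ a) i with hφdef
  have hφ : ∀ k a t, t₀ ≤ t → globalAux C z k i t a = φ k a t := fun k a t ht =>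
    congrFun (eq_consensusFlow_of_hasDerivWithinAt
      (fun s hs => hz.hasDerivWithinAt_globalAux k a hs) ht) i
  have hφa : ∀ k a, AnalyticOnNhd ℝ (φ k a) univ := fun k a =>
    analyticOnNhd_consensusFlow _ _ _ _
  have hlim : ∀ k a, Tendsto (φ k a) atTop (𝓝 (e k a)) := fun k a => by
    have h : Tendsto (fun t => globalAux C z k i t a) atTop (𝓝 (e k a)) :=
      ((EuclideanSpace.proj (𝕜 := ℝ) a).continuous.tendsto (e k)).comp (he k i)
    refine h.congr' ?_
    filter_upwards [eventually_ge_atTop t₀] with t ht using hφ k a t ht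
  -- A minor with nonzero limit is not identically zero, so its zeros are countable; one such minor
  -- suffices, as it vanishes at every time of dependence.
  have key : ∀ a b, e 0 a * e 1 b - e 0 b * e 1 a ≠ 0 →
      {t | φ 0 a t * φ 1 b t - φ 0 b t * φ 1 a t = 0}.Countable := by
    intro a b hab
    have h := ((hlim 0 a).mul (hlim 1 b)).sub ((hlim 0 b).mul (hlim 1 a))
    obtain ⟨t, ht⟩ := (h.eventually_ne hab).exists
    exact countable_zeros_of_analytic
      (((hφa 0 a).mul (hφa 1 b)).sub ((hφa 0 b).mul (hφa 1 a))) ht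
  obtain ⟨a, b, hab⟩ : ∃ a b, e 0 a * e 1 b - e 0 b * e 1 a ≠ 0 := by
    by_contra! h
    refine hLI ?_
    rw [cross_apply, h 1 2, h 2 0, h 0 1]
    simp
  refine (key a b hab).mono ?_
  rintro t ⟨ht, hdep⟩
  rw [← act_globalAux C z 0 i t, ← act_globalAux C z 1 i t, linearIndependent_act_iff,
    linearIndependent_iff_cross, not_not, cross_apply] at hdep
  have h0 := congrFun hdep 0
  have h1 := congrFun hdep 1
  have h2 := congrFun hdep 2
  simp at h0 h1 h2
  rw [Set.mem_ofPred_eq, ← hφ 0 a t ht, ← hφ 0 b t ht, ← hφ 1 a t ht, ← hφ 1 b t ht]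
  fin_cases a <;> fin_cases b <;> simp <;> linarith

end Orientation

/-! ### Position estimation as disturbed consensus -/

section Position

variable {V : Type*} [Fintype V]

/-- The weights of the position estimation law, extended by zero to all pairs of agents. -/
noncomputable def positionWeight (G : WeightedDigraph V) (l : V → V → ℝ) (kᵤ : ℝ) (i j : V) : ℝ :=
  open Classical in if j ∈ G.nbrs i then kᵤ * l i j else 0

lemma positionWeight_nonneg {G : WeightedDigraph V} {l : V → V → ℝ}
    (hl : ∀ i, ∀ j ∈ G.nbrs i, 0 < l i j) {kᵤ : ℝ} (hk : 0 < kᵤ) (i j : V) :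
    0 ≤ positionWeight G l kᵤ i j := by
  unfold positionWeight
  split_ifs with h
  · exact (mul_pos hk (hl i j h)).le
  · exact le_rfl

lemma positionWeight_pos {G : WeightedDigraph V} {l : V → V → ℝ}
    (hl : ∀ i, ∀ j ∈ G.nbrs i, 0 < l i j) {kᵤ : ℝ} (hk : 0 < kᵤ) {i j : V}
    (h : G.IsNbr i j) : 0 < positionWeight G l kᵤ i j := by
  have hj : j ∈ G.nbrs i := G.mem_nbrs.2 h
  rw [positionWeight, if_pos hj]
  exact mul_pos hk (hl i j hj)

lemma sum_positionWeight_mul (G : WeightedDigraph V) (l : V → V → ℝ) (kᵤ : ℝ) (i : V)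
    (f : V → ℝ) :
    ∑ j, positionWeight G l kᵤ i j * f j = kᵤ * ∑ j ∈ G.nbrs i, l i j * f j := by
  classical
  rw [Finset.mul_sum, ← Finset.sum_subset (Finset.subset_univ (G.nbrs i))]
  · exact Finset.sum_congr rfl fun j hj => by rw [positionWeight, if_pos hj, mul_assoc]
  · exact fun j _ hj => by rw [positionWeight, if_neg hj, zero_mul]

/-- The estimated orientation reproduces displacements up to a rotation that depends only on the
auxiliary variables in the global frame. -/
lemma act_estOrientation_transpose {V : Type*} (C : V → SO3) (p : V → E3)
    (z : Fin 2 → V → ℝ → E3) (i j : V) (t : ℝ) :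
    act (estOrientation z i t)ᵀ (relDisplacement C p j i) =
      act (frame (globalAux C z 0 i t) (globalAux C z 1 i t))ᵀ (p j - p i) := by
  rw [estOrientation, ← act_globalAux C z 0 i t, ← act_globalAux C z 1 i t, frame_act,
    relDisplacement, ← act_mul, Matrix.transpose_mul, mul_assoc, transpose_mul_self_SO3, mul_one]

lemma abs_act_transpose_sub_le {A B : Matrix (Fin 3) (Fin 3) ℝ} {ε : ℝ}
    (h : ∀ a b, |A a b - B a b| ≤ ε) (w : E3) (a : Fin 3) :
    |act Bᵀ w a - act Aᵀ w a| ≤ 3 * (ε * ‖w‖) := by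
  have h1 : act Bᵀ w a - act Aᵀ w a = ∑ b, (B b a - A b a) * w b := by
    simp only [ofLp_act, Matrix.mulVec, dotProduct, Matrix.transpose_apply,
      ← Finset.sum_sub_distrib, sub_mul]
  have hε : 0 ≤ ε := (abs_nonneg _).trans (h 0 0)
  rw [h1]
  calc |∑ b, (B b a - A b a) * w b| ≤ ∑ b, |(B b a - A b a) * w b| :=
        Finset.abs_sum_le_sum_abs _ _
    _ ≤ ∑ _b : Fin 3, ε * ‖w‖ := by
        refine Finset.sum_le_sum fun b _ => ?_
        rw [abs_mul, abs_sub_comm]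
        exact mul_le_mul (h b a) (abs_apply_le_norm w b) (abs_nonneg _) hε
    _ = 3 * (ε * ‖w‖) := by simp

/-- The disturbance that the orientation estimation error causes in the position estimation law,
relative to the limiting frame `F`. -/
noncomputable def positionDisturbance (G : WeightedDigraph V) (l : V → V → ℝ) (kᵤ : ℝ)
    (C : V → SO3) (p : V → E3) (z : Fin 2 → V → ℝ → E3) (F : Matrix (Fin 3) (Fin 3) ℝ)
    (a : Fin 3) (t : ℝ) (i : V) : ℝ :=
  ∑ j, positionWeight G l kᵤ i j * (act Fᵀ (p j - p i) a -
    act (frame (globalAux C z 0 i t) (globalAux C z 1 i t))ᵀ (p j - p i) a)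

/-- The deviation of the position estimates from the rotated positions follows a disturbed
consensus dynamics. -/
lemma PositionLaw.hasDerivAt_deviation {G : WeightedDigraph V} {l : V → V → ℝ} {kᵤ : ℝ}
    {C : V → SO3} {p : V → E3} {t₀ : ℝ} {z : Fin 2 → V → ℝ → E3} {phat : V → ℝ → E3}
    (h : PositionLaw G l kᵤ C p t₀ z phat) (F : Matrix (Fin 3) (Fin 3) ℝ) (a : Fin 3) {t : ℝ}
    (ht : t₀ < t) (hLI : ∀ i, LinearIndependent ℝ ![z 0 i t, z 1 i t]) :
    HasDerivAt (fun t i => phat i t a - act Fᵀ (p i) a)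
      (consensusGen (positionWeight G l kᵤ) (fun i => phat i t a - act Fᵀ (p i) a) +
        positionDisturbance G l kᵤ C p z F a t) t := by
  refine hasDerivAt_pi.2 fun i => ?_
  have h1 := (h.2 i t ht.le (hLI i)).hasDerivAt (Ici_mem_nhds ht)
  have h2 := (((EuclideanSpace.proj (𝕜 := ℝ) a).hasFDerivAt.comp_hasDerivAt t h1).sub_const
    (act Fᵀ (p i) a))
  refine h2.congr_deriv ?_
  rw [map_smul, map_sum, Pi.add_apply, consensusGen_apply, positionDisturbance,
    ← Finset.sum_add_distrib]
  simp only [← mul_add]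
  rw [sum_positionWeight_mul, smul_eq_mul]
  congr 1
  refine Finset.sum_congr rfl fun j _ => ?_
  -- Fᵀ (p_j - p_i) enters the generator and the disturbance with opposite signs, so only the frame
  -- at time t survives.
  rw [map_smul, act_estOrientation_transpose, act_sub Fᵀ, smul_eq_mul]
  simp only [PiLp.proj_apply, PiLp.sub_apply]
  ring

/-- The disturbance decays exponentially. -/
lemma exists_abs_positionDisturbance_le {G : WeightedDigraph V} {l : V → V → ℝ}
    (hl : ∀ i, ∀ j ∈ G.nbrs i, 0 < l i j) {kᵤ : ℝ} (hk : 0 < kᵤ) {C : V → SO3} (p : V → E3)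
    {t₀ : ℝ} {z : Fin 2 → V → ℝ → E3} {μ K : ℝ} (hK : 0 < K) {e : Fin 2 → E3}
    (he : ∀ k i t, t₀ ≤ t → ‖globalAux C z k i t - e k‖ ≤ K * Real.exp (-μ * (t - t₀)))
    (hLI : LinearIndependent ℝ ![e 0, e 1]) :
    ∃ c ≥ 0, ∀ a t, t₀ ≤ t → ∀ i,
      |positionDisturbance G l kᵤ C p z (frame (e 0) (e 1)) a t i| ≤
        c * Real.exp (-μ * (t - t₀)) := by
  obtain ⟨M, hM, hframe⟩ := exists_abs_frame_sub_le hLI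
  have hw := positionWeight_nonneg hl hk
  -- The factor 2K comes from the two auxiliary vectors, the factor 3 from the three entries in a
  -- matrix row.
  set g : V → V → ℝ := fun i j => positionWeight G l kᵤ i j * (3 * (M * (2 * K) * ‖p j - p i‖))
  have hg : ∀ i j, 0 ≤ g i j := fun i j => mul_nonneg (hw i j) (by positivity)
  refine ⟨∑ i, ∑ j, g i j, Finset.sum_nonneg fun i _ => Finset.sum_nonneg fun j _ => hg i j,
    fun a t ht i => ?_⟩
  set E := Real.exp (-μ * (t - t₀))
  have hE : 0 < E := Real.exp_pos _
  have hfr : ∀ a b, |frame (globalAux C z 0 i t) (globalAux C z 1 i t) a b -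
      frame (e 0) (e 1) a b| ≤ M * (2 * K) * E := by
    intro a b
    refine (hframe _ _ a b).trans ?_
    rw [mul_assoc]
    refine mul_le_mul_of_nonneg_left ?_ hM.le
    linarith [he 0 i t ht, he 1 i t ht]
  rw [positionDisturbance]
  calc _ ≤ ∑ j, |positionWeight G l kᵤ i j * _| := Finset.abs_sum_le_sum_abs _ _
    _ ≤ ∑ j, g i j * E := by
        refine Finset.sum_le_sum fun j _ => ?_
        rw [abs_mul, abs_of_nonneg (hw i j)]
        simp only [g, mul_assoc (positionWeight G l kᵤ i j)]
        refine mul_le_mul_of_nonneg_left ?_ (hw i j)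
        refine (abs_act_transpose_sub_le hfr (p j - p i) a).trans (le_of_eq ?_)
        ring
    _ = (∑ j, g i j) * E := by rw [Finset.sum_mul]
    _ ≤ (∑ i, ∑ j, g i j) * E := by
        refine mul_le_mul_of_nonneg_right ?_ hE.le
        exact Finset.single_le_sum (f := fun i => ∑ j, g i j)
          (fun i _ => Finset.sum_nonneg fun j _ => hg i j) (Finset.mem_univ i)

end Position

end NetLoc

/-! ### The main theorem -/

open NetLoc in
theorem mainTheorem4 {V : Type*} [Fintype V] (G : NetLoc.WeightedDigraph V)
    (hG : G.HasRootedOutBranch)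
    (l : V → V → ℝ) (hl : ∀ i, ∀ j ∈ G.nbrs i, 0 < l i j) (kᵤ : ℝ) (hk : 0 < kᵤ)
    (C : V → NetLoc.SO3) (p : V → NetLoc.E3) (t₀ : ℝ)
    (z : Fin 2 → V → ℝ → NetLoc.E3) (hz : NetLoc.OrientationLaw G C t₀ z)
    (hq : ∀ c : Fin 2 → ℝ, c ≠ 0 →
      c 0 • NetLoc.qStack C z 0 t₀ + c 1 • NetLoc.qStack C z 1 t₀ ∉ NetLoc.colSpace G) :
    ∃ lam > (0 : ℝ), ∃ η > (0 : ℝ),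
      ∀ phat : V → ℝ → NetLoc.E3, NetLoc.PositionLaw G l kᵤ C p t₀ z phat →
        ∃ pinf : V → NetLoc.E3,
          (∀ i, ∀ t, t₀ ≤ t →
            ‖phat i t - pinf i‖ ≤
              η * Real.exp (-lam * (t - t₀)) * (1 + ∑ j, ‖phat j t₀ - pinf j‖)) ∧
          ∀ i j, ‖pinf j - pinf i‖ = ‖p j - p i‖ := by
  obtain ⟨μ₀, hμ₀, K₀, hK₀, e, he⟩ := hz.exists_limit hG
  have helim := fun k i => tendsto_of_norm_sub_le_exp hμ₀ (he k i)
  have hLI := hz.linearIndependent_limit hq helim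
  obtain ⟨c, hc, hdist⟩ := exists_abs_positionDisturbance_le hl hk p hK₀ he hLI
  obtain ⟨r, hr⟩ := hG
  obtain ⟨μ, hμ, K, hK, hcons⟩ := exists_consensus_rate (positionWeight_nonneg hl hk)
    (fun v => Relation.ReflTransGen.mono (fun _ _ h => positionWeight_pos hl hk h) _ _ (hr v)) hμ₀ hc
  -- The rate and K are fixed before `phat`; the factor 3 sums the three coordinates.
  refine ⟨μ, hμ, 3 * K, by positivity, fun phat hphat => ?_⟩
  set F := frame (e 0) (e 1)
  set N : Set ℝ := ⋃ i, {t | t₀ ≤ t ∧ ¬ LinearIndependent ℝ ![z 0 i t, z 1 i t]} with hN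
  have hNc : N.Countable :=
    Set.countable_iUnion fun i => hz.countable_not_linearIndependent helim hLI i
  have hlim : ∀ a, ∃ d, ∀ t, t₀ ≤ t → ∀ i, |phat i t a - act Fᵀ (p i) a - d| ≤
      K * Real.exp (-μ * (t - t₀)) * (1 + ∑ j, |phat j t₀ a - act Fᵀ (p j) a - d|) := by
    intro a
    refine hcons t₀ (fun t i => phat i t a - act Fᵀ (p i) a)
      (positionDisturbance G l kᵤ C p z F a) N hNc ?_ ?_ (fun t ht _ i => hdist a t ht.le i)
    · exact continuousOn_pi.2 fun i =>
        ((EuclideanSpace.proj (𝕜 := ℝ) a).continuous.comp_continuousOn (hphat.1 i)).sub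
          continuousOn_const
    · intro t ht htN
      refine hphat.hasDerivAt_deviation F a ht fun i => ?_
      by_contra hdep
      exact htN (Set.mem_iUnion.2 ⟨i, ht.le, hdep⟩)
  choose d hd using hlim
  -- F and d do not depend on the agent, so differences of limits are images of p_j - p_i under the
  -- orthogonal matrix Fᵀ.
  refine ⟨fun i => act Fᵀ (p i) + WithLp.toLp 2 d, fun i t ht => ?_, fun i j => ?_⟩
  · have hcomp : ∀ i t a, (phat i t - (act Fᵀ (p i) + WithLp.toLp 2 d)) a =
        phat i t a - act Fᵀ (p i) a - d a := fun i t a => by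
      simp [sub_sub]
    set S := ∑ j, ‖phat j t₀ - (act Fᵀ (p j) + WithLp.toLp 2 d)‖
    have hS : ∀ a, ∑ j, |phat j t₀ a - act Fᵀ (p j) a - d a| ≤ S := fun a =>
      Finset.sum_le_sum fun j _ => by
        rw [← hcomp]
        exact abs_apply_le_norm _ a
    calc ‖phat i t - (act Fᵀ (p i) + WithLp.toLp 2 d)‖
        ≤ ∑ a, |phat i t a - act Fᵀ (p i) a - d a| := by
          refine (norm_le_sum_abs _).trans (le_of_eq ?_)
          exact Finset.sum_congr rfl fun a _ => by rw [hcomp]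
      _ ≤ ∑ _a : Fin 3, K * Real.exp (-μ * (t - t₀)) * (1 + S) := by
          refine Finset.sum_le_sum fun a _ => (hd a t ht i).trans ?_
          gcongr
          exact hS a
      _ = 3 * K * Real.exp (-μ * (t - t₀)) * (1 + S) := by
          rw [Finset.sum_const, Finset.card_univ, Fintype.card_fin, nsmul_eq_mul]
          push_cast
          ring
  · rw [add_sub_add_right_eq_sub, ← act_sub, norm_act_frame_transpose hLI]
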